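/- For every $t\in\mathbb{N}$ let $M_t\ge 2$, $p_t$, $s_{1,t}$, $s_{2,t}$ and $n_{1,t},\dots,n_{M_t,t}$ be natural numbers and let $\mu^{(1)}_t,\dots,\mu^{(M_t)}_t\in\mathbb{R}^{p_t}$ be arbitrary fixed vectors; the index $t$ is suppressed below, and all asymptotic relations are for $t\to\infty$. Put $N=\sum_{m=1}^M n_m$, $n=\min_m n_m$, $s_0=\max(s_1,s_2)$, $\psi_1=\sqrt{\log p/N}$, $\psi_2=\sqrt{(M+\log p)/N}$, and fix constants $0<C_{\min}<C_{\max}$ and $\beta>1$. For a tuple $\Omega^{(\cdot)}=(\Omega^{(1)},\dots,\Omega^{(M)})$ of symmetric positive definite $p\times p$ matrices and $k\in[p]$ let $S_{1,k}=\{j:\Omega^{(1)}_{j,k}=\dots=\Omega^{(M)}_{j,k}\ne 0\}$ and $S_{2,k}=\{j:\text{not all of }\Omega^{(1)}_{j,k},\dots,\Omega^{(M)}_{j,k}\text{ are equal}\}$. Let $\Theta$ be the set of those tuples for which $\max_k|S_{1,k}|\le s_1$, $\max_k|S_{2,k}|\le s_2$ and, for all $m$, the matrix $\Sigma^{(m)}=(\Omega^{(m)})^{-1}$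 has smallest eigenvalue at least $C_{\min}$ and all diagonal entries at most $C_{\max}$. For $\Omega^{(\cdot)}\in\Theta$ the data are independent random vectors $X_i^{(m)}\sim N(\mu^{(m)},\Sigma^{(m)})$, $m\in[M]$, $i\in[n_m]$. For tuples $A^{(\cdot)},B^{(\cdot)}$ of real $p\times p$ matrices and $r\ge 1$ define the $p\times p$ matrices $L_{1,r}$ and $L_{2,r}$ by $$\bigl(L_{1,r}(A^{(\cdot)},B^{(\cdot)})\bigr)_{j,k}=\Bigl(\tfrac1N\sum_{m=1}^M n_m|A^{(m)}_{j,k}-B^{(m)}_{j,k}|\Bigr)^r,\qquad \bigl(L_{2,r}(A^{(\cdot)},B^{(\cdot)})\bigr)_{j,k}=\Bigl(\tfrac1N\sum_{m=1}^M n_m(A^{(m)}_{j,k}-B^{(m)}_{j,k})^2\Bigr)^{r/2},$$ and for $l\in[1,\infty]$ let $\|A\|_l=\sup_{x\ne0}\|Ax\|_l/\|x\|_l$ be the matrix $l$-norm. Assume that $n\to\infty$, $p\to\infty$, $3\le s_1<p/2$, $2\le s_2<p/2$, $s_0^2\log^3 p=o(N)$, $s_2^2M=o(N)$, $N=O(nM)$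 and $N^\beta=O(p)$. Then for every $r\ge1$ and every $l\in[1,\infty]$ there is a constant $c>0$ such that, for all sufficiently large $t$, $$\inf_{\widetilde\Omega^{(\cdot)}}\ \sup_{\Omega^{(\cdot)}\in\Theta}\mathbb{E}\,\|L_{1,r}(\widetilde\Omega^{(\cdot)},\Omega^{(\cdot)})\|_l\ \ge\ c\,(s_1\psi_1^r+s_2\psi_2^r)\quad\text{and}\quad \inf_{\widetilde\Omega^{(\cdot)}}\ \sup_{\Omega^{(\cdot)}\in\Theta}\mathbb{E}\,\|L_{2,r}(\widetilde\Omega^{(\cdot)},\Omega^{(\cdot)})\|_l\ \ge\ c\,(s_1\psi_1^r+s_2\psi_2^r),$$ where the infima are over all measurable functions $\widetilde\Omega^{(\cdot)}$ of the data $(X_i^{(m)})_{m\in[M],\,i\in[n_m]}$ with values in $(\mathbb{R}^{p\times p})^M$. -/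

import Mathlib

open MeasureTheory ProbabilityTheory Filter Asymptotics
open scoped ENNReal Topology

namespace IntegrativePrecision

noncomputable section

/-- `M`-tuples `A^{(·)} = (A^{(1)}, …, A^{(M)})` of real `p × p` matrices. -/
abbrev MatTuple (M p : ℕ) : Type := Fin M → Matrix (Fin p) (Fin p) ℝ

/-- The full collection of samples: `x m i ∈ ℝ^p` is the `i`-th observation at site `m`. -/
abbrev Data {M : ℕ} (p : ℕ) (n : Fin M → ℕ) : Type :=
  (m : Fin M) → Fin (n m) → EuclideanSpace ℝ (Fin p)

/-- Total sample size `N = ∑ n_m`. -/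
def totalSize {M : ℕ} (n : Fin M → ℕ) : ℕ := ∑ m, n m

/-- Minimal local sample size `min_m n_m`. -/
def minSize {M : ℕ} (n : Fin M → ℕ) : ℕ := ⨅ m, n m

/-- Indices in column `k` whose entries are common to all sites and non-zero. -/
def commonSupport {M p : ℕ} (Ω : MatTuple M p) (k : Fin p) : Set (Fin p) :=
  {j | (∀ m m', Ω m j k = Ω m' j k) ∧ ∀ m, Ω m j k ≠ 0}

/-- Indices in column `k` whose entries are not the same at all sites. -/
def heteroSupport {M p : ℕ} (Ω : MatTuple M p) (k : Fin p) : Set (Fin p) :=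
  {j | ¬ ∀ m m', Ω m j k = Ω m' j k}

/-- The parameter space `Θ(s₁, s₂)`. -/
def Theta (M p s₁ s₂ : ℕ) : Set (MatTuple M p) :=
  {Ω | (∀ m, (Ω m).PosDef) ∧ (∀ k, (commonSupport Ω k).ncard ≤ s₁) ∧
    ∀ k, (heteroSupport Ω k).ncard ≤ s₂}

/-- Regular covariances: every `Σ^{(m)} = (Ω^{(m)})⁻¹` has all eigenvalues at least `Cmin` and
all diagonal entries at most `Cmax`. -/
def RegularCov {M p : ℕ} (Cmin Cmax : ℝ) (Ω : MatTuple M p) : Prop :=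
  ∀ m, (∀ t ∈ spectrum ℝ (Ω m)⁻¹, Cmin ≤ t) ∧ ∀ j, (Ω m)⁻¹ j j ≤ Cmax

/-- Joint law of the data: all observations are independent and
`X_i^{(m)} ∼ N(μ^{(m)}, (Ω^{(m)})⁻¹)`. -/
def dataLaw {M p : ℕ} (n : Fin M → ℕ) (μ : Fin M → EuclideanSpace ℝ (Fin p))
    (Ω : MatTuple M p) : Measure (Data p n) :=
  Measure.pi fun m => Measure.pi fun _ : Fin (n m) => multivariateGaussian (μ m) (Ω m)⁻¹

/-- Weighted `ℓ₁` norm on `ℝ^M`, with weights `n_m / N`. -/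
def wnorm₁ {M : ℕ} (n : Fin M → ℕ) (a : Fin M → ℝ) : ℝ :=
  1 / (totalSize n : ℝ) * ∑ m, (n m : ℝ) * |a m|

/-- Weighted `ℓ₂` norm on `ℝ^M`, with weights `n_m / N`. -/
def wnorm₂ {M : ℕ} (n : Fin M → ℕ) (a : Fin M → ℝ) : ℝ :=
  √(1 / (totalSize n : ℝ) * ∑ m, (n m : ℝ) * a m ^ 2)

/-- The integrative loss matrix `L_{1,r}(A, B)`. -/
def loss₁ {M p : ℕ} (n : Fin M → ℕ) (r : ℝ) (A B : MatTuple M p) : Matrix (Fin p) (Fin p) ℝ :=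
  Matrix.of fun j k => wnorm₁ n (fun m => A m j k - B m j k) ^ r

/-- The integrative loss matrix `L_{2,r}(A, B)`. -/
def loss₂ {M p : ℕ} (n : Fin M → ℕ) (r : ℝ) (A B : MatTuple M p) : Matrix (Fin p) (Fin p) ℝ :=
  Matrix.of fun j k => wnorm₂ n (fun m => A m j k - B m j k) ^ r

/-- The matrix `l`-norm `sup_{x ≠ 0} ‖A x‖_l / ‖x‖_l`: the operator norm on `ℝ^p` with the
`ℓ_l` norm. -/
def matNorm (l : ℝ≥0∞) [Fact (1 ≤ l)] {p : ℕ} (A : Matrix (Fin p) (Fin p) ℝ) : ℝ :=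
  ‖(Matrix.toLpLin l l A).toContinuousLinearMap‖

/-- Minimax risk over the regular part of `Θ(s₁, s₂)` for a given loss matrix under the matrix
`l`-norm, as an extended nonnegative number: the infimum is over all (entrywise) measurable
functions of the complete data, and the means `μ` are held fixed. -/
def minimaxRisk (l : ℝ≥0∞) [Fact (1 ≤ l)] {M p : ℕ} (n : Fin M → ℕ)
    (μ : Fin M → EuclideanSpace ℝ (Fin p)) (Cmin Cmax : ℝ) (s₁ s₂ : ℕ)
    (loss : MatTuple M p → MatTuple M p → Matrix (Fin p) (Fin p) ℝ) : ℝ≥0∞ :=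
  ⨅ (est : Data p n → MatTuple M p) (_ : ∀ m j k, Measurable fun x => est x m j k),
    ⨆ Ω ∈ {Ω ∈ Theta M p s₁ s₂ | RegularCov Cmin Cmax Ω},
      ∫⁻ x, ENNReal.ofReal (matNorm l (loss (est x) Ω)) ∂(dataLaw n μ Ω)

/-- `ψ₁ = √(log p / N)`. -/
def psi₁ (p N : ℕ) : ℝ := √(Real.log p / N)

/-- `ψ₂ = √((M + log p) / N)`. -/
def psi₂ (M p N : ℕ) : ℝ := √((M + Real.log p) / N)

end

end IntegrativePrecision

/-!
The lower bound is a Bayes risk bound. All precision matrices that occur are of the form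
`a • (1 + E m)` with `a = 2 / (Cmin + Cmax)` and `E m` a symmetric matrix whose absolute row sums
are at most a small `η`. This makes them positive definite, and puts the spectrum and the diagonal
of the inverse into the required range (`regularCov_of_isSmallSymm`). The matrix `E m` has two
off-diagonal blocks `B m` and `(B m)ᵀ`, and zeros elsewhere.

Every matrix `l`-norm of a nonnegative matrix is at least the average row sum of any square
submatrix, for all `l` at once (`sum_div_card_le_matNorm`), and the loss of the second kind is
entrywise at least the loss of the first kind (`wnorm₁_le_wnorm₂`). So it is enough to bound from
below the losses of single entries of the block, summed over the block and averaged over a uniform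
prior on a finite family of blocks (`le_minimaxRisk_of_forall`). This is Assouad's lemma, in a form
in which the two hypotheses of each binary test may be mixtures (`card_div_four_le_sum_errors`). The
binary tests are controlled by the second moment of the likelihood ratio of the mixture
(`half_card_le_sum_errors`). For Gaussian laws with precision matrices `Ω₀`, `Ω₁`, `Ω₂` the mixed
second moment is a ratio of determinants which involves `Ω₁ + Ω₂ - Ω₀`
(`lintegral_gaussianRatio_mul`). For two perturbations of one symmetric pair of entries, of size
`u`, in the same row `i` it is `exp (O(u²))` if they are equal, and `exp (O(u² η²))` if their
positions differ (`sqrt_det_ratio_le`). The determinants are quadratic in `u` with coefficients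
from the inverse of `1 + E m`, whose entries at zeros of `E m` off the diagonal are `O(η²)`.

Three families give the three parts of the rate.
* Entries of size of order `ψ₁`, equal at all sites, at unknown positions: the block has
  `b k` rows with `b = ⌊√p⌋`, its columns form `k ≈ s₁ / 2` groups of `b`, and each row has at most one
  entry in each group. Absence of this entry cannot be told from presence at a uniformly distributed
  position, since `b` exceeds `exp (O(N ψ₁²))`, a small power of `p`. The positions are constrained to
  leave at most `s₁ - 1` entries in each column, which excludes at most half of the positions of a single
  entry. The `k` groups of a row then contribute `s₁ ψ₁ ^ r` to its loss (`needle_lower_bound`).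
* The same with `s₂` in the place of `s₁`, and with half of the size at one site. Then every entry
  counts as heterogeneous, and the rate is `s₂ ψ₁ ^ r`.
* An `s₂ × s₂` block which has one free bit for every entry and site, of size `1 / (10 √(n m))`. No
  bit can be learned from its site, and the losses of the `M` sites add up to the rate
  `s₂ √(M / N) ^ r` because `N = O(n M)` (`bit_lower_bound`).

As `ψ₂ ≤ √(M / N) + ψ₁`, the largest of the three bounds is of the order `s₁ ψ₁ ^ r + s₂ ψ₂ ^ r`
(`ofReal_rate_le_minimaxRisk`).
-/

namespace IntegrativePrecision

open Matrix

/-! ### Densities of product measures -/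

/-- Tonelli's theorem for a product of functions of the separate coordinates. -/
lemma lintegral_pi_fin_prod {k : ℕ} {E : Fin k → Type*} {mE : ∀ i, MeasurableSpace (E i)}
    {μ : (i : Fin k) → Measure (E i)} [∀ i, SigmaFinite (μ i)] (f : (i : Fin k) → E i → ℝ≥0∞)
    (hf : ∀ i, Measurable (f i)) :
    ∫⁻ x : (i : Fin k) → E i, ∏ i, f i (x i) ∂(Measure.pi μ) = ∏ i, ∫⁻ x, f i x ∂(μ i) := by
  induction k with
  | zero => simp
  | succ k ih =>
    calc
      _ = ∫⁻ x : E 0 × ((i : Fin k) → E i.succ), f 0 x.1 * ∏ i : Fin k, f i.succ (x.2 i)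
            ∂((μ 0).prod (Measure.pi fun i => μ i.succ)) := by
          refine (((measurePreserving_piFinSuccAbove μ 0).symm).lintegral_map_equiv _).trans ?_
          refine lintegral_congr fun x => ?_
          rw [Fin.prod_univ_succ]
          rfl
      _ = (∫⁻ x, f 0 x ∂μ 0) * ∏ i : Fin k, ∫⁻ x, f i.succ x ∂μ i.succ := by
          rw [← ih _ fun i => hf i.succ, ← lintegral_prod_mul (hf 0).aemeasurable
            (Finset.measurable_prod _ fun i _ =>
              (hf i.succ).comp (measurable_pi_apply i)).aemeasurable]
      _ = _ := by rw [Fin.prod_univ_succ]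

lemma pi_withDensity {k : ℕ} {E : Fin k → Type*} {mE : ∀ i, MeasurableSpace (E i)}
    {μ ν : (i : Fin k) → Measure (E i)} [∀ i, SigmaFinite (μ i)] [∀ i, SigmaFinite (ν i)]
    (f : (i : Fin k) → E i → ℝ≥0∞) (hf : ∀ i, Measurable (f i))
    (hν : ∀ i, ν i = (μ i).withDensity (f i)) :
    Measure.pi ν = (Measure.pi μ).withDensity fun x => ∏ i, f i (x i) := by
  refine Measure.pi_eq fun s hs => ?_
  rw [withDensity_apply _ (MeasurableSet.univ_pi hs), Measure.restrict_pi_pi,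
    lintegral_pi_fin_prod _ hf]
  exact Finset.prod_congr rfl fun i _ => by rw [hν i, withDensity_apply _ (hs i)]

lemma map_withDensity_comp {α β : Type*} {mα : MeasurableSpace α} {mβ : MeasurableSpace β}
    (μ : Measure α) {f : α → β} (hf : Measurable f) {g : β → ℝ≥0∞} (hg : Measurable g) :
    (μ.withDensity fun x => g (f x)).map f = (μ.map f).withDensity g := by
  ext s hs
  rw [Measure.map_apply hf hs, withDensity_apply _ (hf hs), withDensity_apply _ hs,
    setLIntegral_map hs hg hf]

/-! ### The Gaussian density in terms of the precision matrix -/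

/-- The Lebesgue density of the normal law with mean `m` and precision matrix `Ω`. -/
noncomputable def gaussianDensity {p : ℕ} (m : EuclideanSpace ℝ (Fin p))
    (Ω : Matrix (Fin p) (Fin p) ℝ) (x : EuclideanSpace ℝ (Fin p)) : ℝ :=
  √Ω.det * ((√(2 * Real.pi))⁻¹ ^ p * Real.exp (-((x - m).ofLp ⬝ᵥ Ω *ᵥ (x - m).ofLp) / 2))

lemma measurable_gaussianDensity {p : ℕ} (m : EuclideanSpace ℝ (Fin p))
    (Ω : Matrix (Fin p) (Fin p) ℝ) : Measurable (gaussianDensity m Ω) := by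
  have : Continuous (gaussianDensity m Ω) := by
    unfold gaussianDensity
    simp only [dotProduct, mulVec]
    fun_prop
  exact this.measurable

lemma stdGaussian_eq_withDensity (p : ℕ) :
    stdGaussian (EuclideanSpace ℝ (Fin p)) =
      volume.withDensity fun x => ENNReal.ofReal (gaussianDensity 0 1 x) := by
  have h1 : (Measure.pi fun _ : Fin p => gaussianReal 0 1) =
      (Measure.pi fun _ : Fin p => (volume : Measure ℝ)).withDensity
        fun x => ∏ i, gaussianPDF 0 1 (x i) :=
    pi_withDensity _ (fun _ => measurable_gaussianPDF 0 1)
      fun _ => gaussianReal_of_var_ne_zero 0 one_ne_zero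
  have h2 : (fun x : Fin p → ℝ => ∏ i, gaussianPDF 0 1 (x i)) =
      fun x => ENNReal.ofReal (gaussianDensity 0 1 (WithLp.toLp 2 x)) := by
    ext x
    simp only [gaussianPDF]
    rw [← ENNReal.ofReal_prod_of_nonneg fun i _ => gaussianPDFReal_nonneg _ _ _]
    congr 1
    simp only [gaussianPDFReal, gaussianDensity, Finset.prod_mul_distrib, ← Real.exp_sum]
    simp [dotProduct, Finset.sum_div, neg_div, pow_two]
  rw [← map_pi_eq_stdGaussian, h1, h2, map_withDensity_comp _ (by fun_prop)
    (measurable_gaussianDensity 0 1).ennreal_ofReal, ← volume_pi,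
    (PiLp.volume_preserving_toLp (Fin p)).map_eq]

open scoped MatrixOrder in
/-- The law is the image of the standard normal law under the affine map with linear part the square
root of `Ω⁻¹`, and this image is computed by a linear change of variables. -/
lemma multivariateGaussian_eq_withDensity {p : ℕ} (m : EuclideanSpace ℝ (Fin p))
    {Ω : Matrix (Fin p) (Fin p) ℝ} (hΩ : Ω.PosDef) :
    multivariateGaussian m Ω⁻¹ =
      volume.withDensity fun x => ENNReal.ofReal (gaussianDensity m Ω x) := by
  set A : Matrix (Fin p) (Fin p) ℝ := CFC.sqrt Ω⁻¹ with hA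
  have hdet : 0 < Ω.det := hΩ.det_pos
  have hAA : A * A = Ω⁻¹ := CFC.sqrt_mul_sqrt_self _ hΩ.inv.posSemidef.nonneg
  have hAT : Aᵀ = A := by
    have := (CFC.sqrt_nonneg Ω⁻¹).isSelfAdjoint
    simpa [IsSelfAdjoint, star_eq_conjTranspose] using this
  have hdetA : A.det * A.det = Ω.det⁻¹ := by
    rw [← det_mul, hAA, det_nonsing_inv, Ring.inverse_eq_inv']
  have hdetA0 : A.det ≠ 0 := by
    intro h; rw [h] at hdetA; simp at hdetA; exact hdet.ne hdetA
  have hAΩA : A * Ω * A = 1 := by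
    have h1 : A * (A * Ω) = 1 := by
      rw [← Matrix.mul_assoc, hAA, nonsing_inv_mul _ hdet.ne'.isUnit]
    exact mul_eq_one_comm.1 h1
  have habs : |A.det⁻¹| = √Ω.det := by
    rw [← Real.sqrt_sq_eq_abs, inv_pow, pow_two, hdetA, inv_inv]
  let h : EuclideanSpace ℝ (Fin p) → ℝ := fun x =>
    (√(2 * Real.pi))⁻¹ ^ p * Real.exp (-((x - m).ofLp ⬝ᵥ Ω *ᵥ (x - m).ofLp) / 2)
  have hh : Measurable fun x => ENNReal.ofReal (h x) := by
    have : Continuous h := by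
      simp only [h, dotProduct, mulVec]
      fun_prop
    exact this.measurable.ennreal_ofReal
  have hcomp : (fun x => ENNReal.ofReal (gaussianDensity (0 : EuclideanSpace ℝ (Fin p)) 1 x)) =
      fun x => ENNReal.ofReal (h (m + toEuclideanCLM (𝕜 := ℝ) A x)) := by
    ext x
    congr 1
    simp only [gaussianDensity, h]
    have : ((m + toEuclideanCLM (𝕜 := ℝ) A x - m).ofLp ⬝ᵥ
        Ω *ᵥ (m + toEuclideanCLM (𝕜 := ℝ) A x - m).ofLp) = x.ofLp ⬝ᵥ x.ofLp := by
      rw [add_sub_cancel_left, ofLp_toEuclideanCLM, mulVec_mulVec, dotProduct_comm,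
        dotProduct_mulVec, ← mulVec_transpose, mulVec_mulVec, hAT, ← Matrix.mul_assoc, hAΩA,
        one_mulVec]
    rw [this]
    simp
  have hmap : (volume : Measure (EuclideanSpace ℝ (Fin p))).map
      (fun x => m + toEuclideanCLM (𝕜 := ℝ) A x) = ENNReal.ofReal |A.det⁻¹| • volume := by
    have h1 : (fun x => m + toEuclideanCLM (𝕜 := ℝ) A x) =
      (fun x => m + x) ∘ (toEuclideanCLM (𝕜 := ℝ) A : _ →ₗ[ℝ] _) := rfl
    have hd : LinearMap.det ((toEuclideanCLM (𝕜 := ℝ) A : _ →L[ℝ] _) :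
        EuclideanSpace ℝ (Fin p) →ₗ[ℝ] EuclideanSpace ℝ (Fin p)) = A.det := by
      rw [coe_toEuclideanCLM_eq_toEuclideanLin]
      change LinearMap.det (toLpLin 2 2 A) = A.det
      rw [toLpLin_eq_toLin, LinearMap.det_toLin]
    rw [h1, ← Measure.map_map (measurable_const_add m) (by
      exact (toEuclideanCLM (𝕜 := ℝ) A).continuous.measurable),
      Measure.map_linearMap_addHaar_eq_smul_addHaar _ (by rw [hd]; exact hdetA0), hd,
      Measure.map_smul, map_add_left_eq_self]
  rw [multivariateGaussian, ← hA, stdGaussian_eq_withDensity, hcomp,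
    map_withDensity_comp _ (by fun_prop) hh, hmap, withDensity_smul_measure,
    ← withDensity_smul _ hh]
  congr 1
  ext x
  rw [Pi.smul_apply, smul_eq_mul, habs, ← ENNReal.ofReal_mul (Real.sqrt_nonneg _)]
  rfl

lemma gaussianDensity_pos {p : ℕ} (m : EuclideanSpace ℝ (Fin p))
    {Ω : Matrix (Fin p) (Fin p) ℝ} (hΩ : Ω.PosDef) (x : EuclideanSpace ℝ (Fin p)) :
    0 < gaussianDensity m Ω x := by
  have := Real.sqrt_pos.2 hΩ.det_pos
  have := Real.pi_pos
  unfold gaussianDensity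
  positivity

lemma lintegral_gaussianDensity {p : ℕ} (m : EuclideanSpace ℝ (Fin p))
    {Ω : Matrix (Fin p) (Fin p) ℝ} (hΩ : Ω.PosDef) :
    ∫⁻ x, ENNReal.ofReal (gaussianDensity m Ω x) = 1 := by
  rw [← setLIntegral_univ, ← withDensity_apply _ MeasurableSet.univ,
    ← multivariateGaussian_eq_withDensity m hΩ, measure_univ]

/-- The likelihood ratio of two normal laws with common mean `m` and precision matrices `Ω₁`
(numerator) and `Ω₀` (denominator). -/
noncomputable def gaussianRatio {p : ℕ} (m : EuclideanSpace ℝ (Fin p))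
    (Ω₀ Ω₁ : Matrix (Fin p) (Fin p) ℝ) (x : EuclideanSpace ℝ (Fin p)) : ℝ≥0∞ :=
  ENNReal.ofReal (gaussianDensity m Ω₁ x / gaussianDensity m Ω₀ x)

lemma measurable_gaussianRatio {p : ℕ} (m : EuclideanSpace ℝ (Fin p))
    (Ω₀ Ω₁ : Matrix (Fin p) (Fin p) ℝ) : Measurable (gaussianRatio m Ω₀ Ω₁) :=
  ((measurable_gaussianDensity m Ω₁).div (measurable_gaussianDensity m Ω₀)).ennreal_ofReal

lemma multivariateGaussian_eq_withDensity_ratio {p : ℕ} (m : EuclideanSpace ℝ (Fin p))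
    {Ω₀ Ω₁ : Matrix (Fin p) (Fin p) ℝ} (h₀ : Ω₀.PosDef) (h₁ : Ω₁.PosDef) :
    multivariateGaussian m Ω₁⁻¹ =
      (multivariateGaussian m Ω₀⁻¹).withDensity (gaussianRatio m Ω₀ Ω₁) := by
  rw [multivariateGaussian_eq_withDensity m h₁, multivariateGaussian_eq_withDensity m h₀,
    ← withDensity_mul _ (measurable_gaussianDensity m Ω₀).ennreal_ofReal
      (measurable_gaussianRatio m Ω₀ Ω₁)]
  congr 1
  ext x
  have := gaussianDensity_pos m h₀ x
  rw [Pi.mul_apply, gaussianRatio, ← ENNReal.ofReal_mul this.le, mul_div_cancel₀ _ this.ne']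

/-- The mixed second moment of two Gaussian likelihood ratios: up to a determinantal constant the
integrand `f₁ f₂ / f₀` is the normal density with precision matrix `Ω₁ + Ω₂ - Ω₀`. -/
lemma lintegral_gaussianRatio_mul {p : ℕ} (m : EuclideanSpace ℝ (Fin p))
    {Ω₀ Ω₁ Ω₂ Ω₃ : Matrix (Fin p) (Fin p) ℝ} (h₀ : Ω₀.PosDef)
    (h₃ : Ω₃.PosDef) (h : Ω₁ + Ω₂ = Ω₀ + Ω₃) :
    ∫⁻ x, gaussianRatio m Ω₀ Ω₁ x * gaussianRatio m Ω₀ Ω₂ x ∂(multivariateGaussian m Ω₀⁻¹) =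
      ENNReal.ofReal (√Ω₁.det * √Ω₂.det / (√Ω₀.det * √Ω₃.det)) := by
  rw [multivariateGaussian_eq_withDensity m h₀, lintegral_withDensity_eq_lintegral_mul _
    (measurable_gaussianDensity m Ω₀).ennreal_ofReal
    (g := fun x => gaussianRatio m Ω₀ Ω₁ x * gaussianRatio m Ω₀ Ω₂ x)
    ((measurable_gaussianRatio m Ω₀ Ω₁).mul (measurable_gaussianRatio m Ω₀ Ω₂))]
  have key : ∀ x, ((fun x => ENNReal.ofReal (gaussianDensity m Ω₀ x)) *
      fun x => gaussianRatio m Ω₀ Ω₁ x * gaussianRatio m Ω₀ Ω₂ x) x =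
      ENNReal.ofReal (√Ω₁.det * √Ω₂.det / (√Ω₀.det * √Ω₃.det)) *
        ENNReal.ofReal (gaussianDensity m Ω₃ x) := by
    intro x
    have p0 := gaussianDensity_pos m h₀ x
    have d0 := Real.sqrt_pos.2 h₀.det_pos
    have d3 := Real.sqrt_pos.2 h₃.det_pos
    have hnn : ∀ Ω, 0 ≤ gaussianDensity m Ω x := fun Ω => by unfold gaussianDensity; positivity
    rw [Pi.mul_apply, gaussianRatio, gaussianRatio,
      ← ENNReal.ofReal_mul (div_nonneg (hnn _) (hnn _)), ← ENNReal.ofReal_mul p0.le,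
      ← ENNReal.ofReal_mul (by positivity)]
    congr 1
    have e : Real.exp (-((x - m).ofLp ⬝ᵥ Ω₁ *ᵥ (x - m).ofLp) / 2) *
        Real.exp (-((x - m).ofLp ⬝ᵥ Ω₂ *ᵥ (x - m).ofLp) / 2) =
        Real.exp (-((x - m).ofLp ⬝ᵥ Ω₀ *ᵥ (x - m).ofLp) / 2) *
        Real.exp (-((x - m).ofLp ⬝ᵥ Ω₃ *ᵥ (x - m).ofLp) / 2) := by
      rw [← Real.exp_add, ← Real.exp_add]
      congr 1
      have : (x - m).ofLp ⬝ᵥ (Ω₁ + Ω₂) *ᵥ (x - m).ofLp =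
        (x - m).ofLp ⬝ᵥ (Ω₀ + Ω₃) *ᵥ (x - m).ofLp := by rw [h]
      simp only [add_mulVec, dotProduct_add] at this
      linarith
    have hc : (√(2 * Real.pi))⁻¹ ^ p ≠ 0 := by have := Real.pi_pos; positivity
    unfold gaussianDensity at p0 ⊢
    have e0 := Real.exp_pos (-((x - m).ofLp ⬝ᵥ Ω₀ *ᵥ (x - m).ofLp) / 2)
    generalize (√(2 * Real.pi))⁻¹ ^ p = c at *
    generalize Real.exp (-((x - m).ofLp ⬝ᵥ Ω₀ *ᵥ (x - m).ofLp) / 2) = E₀ at *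
    generalize Real.exp (-((x - m).ofLp ⬝ᵥ Ω₁ *ᵥ (x - m).ofLp) / 2) = E₁ at *
    generalize Real.exp (-((x - m).ofLp ⬝ᵥ Ω₂ *ᵥ (x - m).ofLp) / 2) = E₂ at *
    generalize Real.exp (-((x - m).ofLp ⬝ᵥ Ω₃ *ᵥ (x - m).ofLp) / 2) = E₃ at *
    field_simp
    linear_combination (√Ω₁.det * √Ω₂.det) * e
  rw [lintegral_congr key, lintegral_const_mul _ (measurable_gaussianDensity m Ω₃).ennreal_ofReal,
    lintegral_gaussianDensity m h₃, mul_one]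

/-! ### The law of the data -/

/-- The likelihood ratio of the complete data under the precision tuples `Ω₁` and `Ω₀`. -/
noncomputable def dataRatio {M p : ℕ} (n : Fin M → ℕ) (μ : Fin M → EuclideanSpace ℝ (Fin p))
    (Ω₀ Ω₁ : MatTuple M p) (x : Data p n) : ℝ≥0∞ :=
  ∏ m, ∏ i, gaussianRatio (μ m) (Ω₀ m) (Ω₁ m) (x m i)

instance {M p : ℕ} (n : Fin M → ℕ) (μ : Fin M → EuclideanSpace ℝ (Fin p)) (Ω : MatTuple M p) :
    IsProbabilityMeasure (dataLaw n μ Ω) := by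
  unfold dataLaw
  infer_instance

lemma measurable_dataRatio {M p : ℕ} (n : Fin M → ℕ) (μ : Fin M → EuclideanSpace ℝ (Fin p))
    (Ω₀ Ω₁ : MatTuple M p) : Measurable (dataRatio n μ Ω₀ Ω₁) :=
  Finset.measurable_prod _ fun m _ => Finset.measurable_prod _ fun i _ =>
    (measurable_gaussianRatio _ _ _).comp ((measurable_pi_apply i).comp (measurable_pi_apply m))

lemma dataLaw_eq_withDensity {M p : ℕ} (n : Fin M → ℕ) (μ : Fin M → EuclideanSpace ℝ (Fin p))
    {Ω₀ Ω₁ : MatTuple M p} (h₀ : ∀ m, (Ω₀ m).PosDef) (h₁ : ∀ m, (Ω₁ m).PosDef) :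
    dataLaw n μ Ω₁ = (dataLaw n μ Ω₀).withDensity (dataRatio n μ Ω₀ Ω₁) := by
  refine pi_withDensity
    (fun m (y : Fin (n m) → EuclideanSpace ℝ (Fin p)) => ∏ i, gaussianRatio (μ m) (Ω₀ m) (Ω₁ m) (y i))
    (fun m => Finset.measurable_prod _ fun i _ =>
      (measurable_gaussianRatio _ _ _).comp (measurable_pi_apply i)) fun m => ?_
  exact pi_withDensity (fun _ => gaussianRatio (μ m) (Ω₀ m) (Ω₁ m))
    (fun _ => measurable_gaussianRatio _ _ _)
    fun _ => multivariateGaussian_eq_withDensity_ratio _ (h₀ m) (h₁ m)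

lemma lintegral_dataRatio_mul {M p : ℕ} (n : Fin M → ℕ) (μ : Fin M → EuclideanSpace ℝ (Fin p))
    {Ω₀ Ω₁ Ω₂ Ω₃ : MatTuple M p} (h₀ : ∀ m, (Ω₀ m).PosDef)
    (h₃ : ∀ m, (Ω₃ m).PosDef) (h : ∀ m, Ω₁ m + Ω₂ m = Ω₀ m + Ω₃ m) :
    ∫⁻ x, dataRatio n μ Ω₀ Ω₁ x * dataRatio n μ Ω₀ Ω₂ x ∂(dataLaw n μ Ω₀) =
      ∏ m, ENNReal.ofReal (√(Ω₁ m).det * √(Ω₂ m).det / (√(Ω₀ m).det * √(Ω₃ m).det)) ^ n m := by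
  have hm : ∀ m, Measurable fun z => gaussianRatio (μ m) (Ω₀ m) (Ω₁ m) z *
      gaussianRatio (μ m) (Ω₀ m) (Ω₂ m) z := fun m =>
    (measurable_gaussianRatio _ _ _).mul (measurable_gaussianRatio _ _ _)
  simp only [dataRatio, ← Finset.prod_mul_distrib]
  rw [dataLaw, lintegral_pi_fin_prod (fun m (y : Fin (n m) → EuclideanSpace ℝ (Fin p)) =>
    ∏ i, (gaussianRatio (μ m) (Ω₀ m) (Ω₁ m) (y i) * gaussianRatio (μ m) (Ω₀ m) (Ω₂ m) (y i)))
    fun m => Finset.measurable_prod _ fun i _ => (hm m).comp (measurable_pi_apply i)]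
  refine Finset.prod_congr rfl fun m _ => ?_
  rw [lintegral_pi_fin_prod (fun _ z => gaussianRatio (μ m) (Ω₀ m) (Ω₁ m) z *
      gaussianRatio (μ m) (Ω₀ m) (Ω₂ m) z) fun _ => hm m,
    Finset.prod_const, Finset.card_univ, Fintype.card_fin,
    lintegral_gaussianRatio_mul _ (h₀ m) (h₃ m) (h m)]

/-! ### Testing against a mixture -/

/-- `min a s ≥ s - s² / (4a)`: this turns a second moment bound for a likelihood ratio into a lower
bound for the testing error. -/
lemma le_min_add_sq_div (a : ℝ≥0∞) (ha : a ≠ 0) (ha' : a ≠ ∞) (s : ℝ≥0∞) :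
    s ≤ min a s + s * s / (4 * a) := by
  rcases eq_or_ne s ∞ with rfl | hs
  · have h : 4 * a ≠ ∞ := ENNReal.mul_ne_top (by simp) ha'
    rw [ENNReal.top_mul_top, ENNReal.top_div_of_ne_top h, add_top]
  · lift s to NNReal using hs
    lift a to NNReal using ha'
    have ha0 : a ≠ 0 := by simpa using ha
    have h4 : (4 * (a : ℝ≥0∞)) = ((4 * a : NNReal) : ℝ≥0∞) := by push_cast; rfl
    rw [h4, ← ENNReal.coe_mul, ← ENNReal.coe_div (by positivity), ← ENNReal.coe_min,
      ← ENNReal.coe_add, ENNReal.coe_le_coe, ← NNReal.coe_le_coe]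
    push_cast
    have hapos : (0 : ℝ) < a := by positivity
    rcases le_total (s : ℝ) a with h | h
    · rw [min_eq_right h]
      have : (0 : ℝ) ≤ s * s / (4 * a) := by positivity
      linarith
    · rw [min_eq_left h, ← sub_le_iff_le_add', le_div_iff₀ (by positivity)]
      nlinarith [sq_nonneg ((s : ℝ) - 2 * a)]

/-- Lower bound for the summed error probabilities of a test between `P` and the uniform mixture of
the laws with `P`-densities `g j`, from a bound on the second moment of the mixture. -/
lemma half_card_le_sum_errors {X J : Type*} {mX : MeasurableSpace X} (P : Measure X)
    (A : Finset J) (Q : J → Measure X) (g : J → X → ℝ≥0∞) [∀ j, IsProbabilityMeasure (Q j)]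
    (hg : ∀ j ∈ A, Measurable (g j)) (hQ : ∀ j ∈ A, Q j = P.withDensity (g j))
    (hsq : ∑ j ∈ A, ∑ k ∈ A, ∫⁻ x, g j x * g k x ∂P ≤ 2 * (A.card : ℝ≥0∞) ^ 2)
    {B : Set X} (hB : MeasurableSet B) :
    (A.card : ℝ≥0∞) / 2 ≤ ∑ j ∈ A, (P B + Q j Bᶜ) := by
  rcases A.eq_empty_or_nonempty with rfl | hA
  · simp
  set a : ℝ≥0∞ := (A.card : ℝ≥0∞) with ha
  have ha0 : a ≠ 0 := by simpa [ha] using hA.ne_empty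
  have hat : a ≠ ∞ := by simp [ha]
  set S : X → ℝ≥0∞ := fun x => ∑ j ∈ A, g j x with hS
  have hSm : Measurable S := Finset.measurable_sum _ hg
  have hint : ∫⁻ x, S x ∂P = a := by
    rw [lintegral_finsetSum _ hg]
    have : ∀ j ∈ A, ∫⁻ x, g j x ∂P = 1 := fun j hj => by
      rw [← setLIntegral_univ, ← withDensity_apply _ MeasurableSet.univ, ← hQ j hj, measure_univ]
    rw [Finset.sum_congr rfl this]
    simp [ha]
  have hSS : ∫⁻ x, S x * S x / (4 * a) ∂P ≤ a / 2 := by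
    have h1 : ∫⁻ x, S x * S x ∂P ≤ 2 * a ^ 2 := by
      refine le_of_eq_of_le ?_ hsq
      have hgg : ∀ j ∈ A, ∀ k ∈ A, Measurable fun x => g j x * g k x :=
        fun j hj k hk => (hg j hj).mul (hg k hk)
      simp only [hS, Finset.sum_mul_sum]
      rw [lintegral_finsetSum _ fun j hj => Finset.measurable_sum _ (hgg j hj)]
      exact Finset.sum_congr rfl fun j hj => lintegral_finsetSum _ (hgg j hj)
    simp only [div_eq_mul_inv]
    have hSm2 : Measurable fun x => S x * S x := hSm.mul hSm
    rw [lintegral_mul_const _ hSm2, ← div_eq_mul_inv, ← div_eq_mul_inv]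
    refine ENNReal.div_le_of_le_mul (h1.trans (le_of_eq ?_))
    rw [ENNReal.div_eq_inv_mul, show 2⁻¹ * a * (4 * a) = (2⁻¹ * 2) * 2 * (a * a) by
      rw [show (4 : ℝ≥0∞) = 2 * 2 by norm_num]; ring, ENNReal.inv_mul_cancel (by simp) (by simp)]
    ring
  have hmin : ∫⁻ x, min a (S x) ∂P ≤ ∑ j ∈ A, (P B + Q j Bᶜ) := by
    rw [Finset.sum_add_distrib, Finset.sum_const, nsmul_eq_mul, ← ha,
      ← lintegral_add_compl _ hB]
    refine add_le_add ?_ ?_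
    · refine (lintegral_mono fun x => min_le_left a _).trans (le_of_eq ?_)
      rw [setLIntegral_const]
    · refine (lintegral_mono fun x => min_le_right a _).trans (le_of_eq ?_)
      rw [lintegral_finsetSum _ hg]
      exact Finset.sum_congr rfl fun j hj => by rw [hQ j hj, withDensity_apply _ hB.compl]
  have htot : a ≤ ∫⁻ x, min a (S x) ∂P + a / 2 := by
    calc a = ∫⁻ x, S x ∂P := hint.symm
      _ ≤ ∫⁻ x, (min a (S x) + S x * S x / (4 * a)) ∂P :=
        lintegral_mono fun x => le_min_add_sq_div a ha0 hat _
      _ = ∫⁻ x, min a (S x) ∂P + ∫⁻ x, S x * S x / (4 * a) ∂P :=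
        lintegral_add_left (measurable_const.min hSm) _
      _ ≤ _ := by gcongr
  refine le_trans ?_ hmin
  have h2 : a / 2 + a / 2 ≤ ∫⁻ x, min a (S x) ∂P + a / 2 := by rwa [ENNReal.add_halves]
  exact (ENNReal.add_le_add_iff_right (ENNReal.div_ne_top hat two_ne_zero)).1 h2

/-! ### Small symmetric perturbations of the identity matrix -/

/-- Symmetric matrices whose absolute row sums are at most `η`. -/
structure IsSmallSymm {p : ℕ} (η : ℝ) (E : Matrix (Fin p) (Fin p) ℝ) : Prop where
  symm : ∀ x y, E x y = E y x
  row_sum : ∀ x, ∑ y, |E x y| ≤ η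

namespace IsSmallSymm

variable {p : ℕ} {η : ℝ} {E : Matrix (Fin p) (Fin p) ℝ}

lemma abs_dotProduct_le (hE : IsSmallSymm η E) (v : Fin p → ℝ) :
    |v ⬝ᵥ E *ᵥ v| ≤ η * (v ⬝ᵥ v) := by
  have h1 : ∑ x, ∑ y, |E x y| * v x ^ 2 ≤ η * (v ⬝ᵥ v) := by
    rw [dotProduct, Finset.mul_sum]
    refine Finset.sum_le_sum fun x _ => ?_
    rw [← Finset.sum_mul, ← pow_two]
    exact mul_le_mul_of_nonneg_right (hE.row_sum x) (sq_nonneg _)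
  have h2 : ∑ x, ∑ y, |E x y| * v y ^ 2 = ∑ x, ∑ y, |E x y| * v x ^ 2 := by
    rw [Finset.sum_comm]
    exact Finset.sum_congr rfl fun x _ => Finset.sum_congr rfl fun y _ => by rw [hE.symm]
  have h3 : |v ⬝ᵥ E *ᵥ v| ≤ ∑ x, ∑ y, (|E x y| * v x ^ 2 + |E x y| * v y ^ 2) / 2 := by
    simp only [dotProduct, mulVec, Finset.mul_sum]
    refine (Finset.abs_sum_le_sum_abs _ _).trans (Finset.sum_le_sum fun x _ => ?_)
    refine (Finset.abs_sum_le_sum_abs _ _).trans (Finset.sum_le_sum fun y _ => ?_)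
    rw [abs_mul, abs_mul, ← sq_abs (v x), ← sq_abs (v y)]
    nlinarith [mul_nonneg (abs_nonneg (E x y)) (sq_nonneg (|v x| - |v y|))]
  simp only [← Finset.sum_div, Finset.sum_add_distrib] at h3
  linarith

lemma posDef_one_add (hE : IsSmallSymm η E) (hη : η < 1) : (1 + E).PosDef := by
  refine PosDef.of_dotProduct_mulVec_pos ?_ fun v hv => ?_
  · ext x y
    simp [hE.symm x y, one_apply, eq_comm]
  · have h1 := abs_le.1 (hE.abs_dotProduct_le v)
    have h2 : 0 < v ⬝ᵥ v := by
      simpa using dotProduct_star_self_pos_iff.2 hv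
    simp only [star_trivial, add_mulVec, one_mulVec, dotProduct_add]
    nlinarith

lemma det_ne_zero (hE : IsSmallSymm η E) (hη : η < 1) : (1 + E).det ≠ 0 :=
  (hE.posDef_one_add hη).det_pos.ne'

/-- The identity `G⁻¹ = 1 - E G⁻¹` for `G = 1 + E`, which gives all bounds for entries of `G⁻¹`. -/
lemma inv_apply_eq (hE : IsSmallSymm η E) (hη : η < 1) (x y : Fin p) :
    (1 + E)⁻¹ x y = (if x = y then 1 else 0) - ∑ z, E x z * (1 + E)⁻¹ z y := by
  have h := mul_nonsing_inv (1 + E) (hE.det_ne_zero hη).isUnit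
  have h2 := congr_fun (congr_fun h x) y
  rw [add_mul, one_mul, Matrix.add_apply, mul_apply, one_apply] at h2
  linarith

lemma abs_inv_apply_le (hE : IsSmallSymm η E) (hη : η < 1) (x y : Fin p) :
    |(1 + E)⁻¹ x y| ≤ 1 / (1 - η) := by
  have hp : (Finset.univ : Finset (Fin p)).Nonempty := ⟨x, Finset.mem_univ _⟩
  obtain ⟨w, -, hw⟩ := Finset.exists_max_image Finset.univ (fun z => |(1 + E)⁻¹ z y|) hp
  have h1 : |∑ z, E w z * (1 + E)⁻¹ z y| ≤ η * |(1 + E)⁻¹ w y| := by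
    refine (Finset.abs_sum_le_sum_abs _ _).trans ?_
    refine le_trans (Finset.sum_le_sum (g := fun z => |E w z| * |(1 + E)⁻¹ w y|) fun z _ => ?_) ?_
    · rw [abs_mul]
      exact mul_le_mul_of_nonneg_left (hw z (Finset.mem_univ _)) (abs_nonneg _)
    · rw [← Finset.sum_mul]
      exact mul_le_mul_of_nonneg_right (hE.row_sum w) (abs_nonneg _)
  have h2 : |(1 + E)⁻¹ w y| ≤ 1 + η * |(1 + E)⁻¹ w y| := by
    conv_lhs => rw [hE.inv_apply_eq hη w y]
    refine (abs_sub _ _).trans (add_le_add ?_ h1)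
    split_ifs <;> simp
  refine (hw x (Finset.mem_univ _)).trans ?_
  rw [le_div_iff₀ (by linarith)]
  linarith

lemma abs_sum_mul_inv_le (hE : IsSmallSymm η E) (x y : Fin p) {c : ℝ}
    (hc : ∀ z, E x z ≠ 0 → |(1 + E)⁻¹ z y| ≤ c) :
    |∑ z, E x z * (1 + E)⁻¹ z y| ≤ η * max c 0 := by
  refine (Finset.abs_sum_le_sum_abs _ _).trans ?_
  refine le_trans (Finset.sum_le_sum (g := fun z => |E x z| * max c 0) fun z _ => ?_) ?_
  · rw [abs_mul]
    rcases eq_or_ne (E x z) 0 with h | h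
    · simp [h]
    · exact mul_le_mul_of_nonneg_left ((hc z h).trans (le_max_left _ _)) (abs_nonneg _)
  · rw [← Finset.sum_mul]
    exact mul_le_mul_of_nonneg_right (hE.row_sum x) (le_max_right _ _)

lemma nonneg (hE : IsSmallSymm η E) (x : Fin p) : 0 ≤ η :=
  (Finset.sum_nonneg fun y _ => abs_nonneg (E x y)).trans (hE.row_sum x)

lemma abs_inv_apply_le_of_ne (hE : IsSmallSymm η E) (hη : η < 1) {x y : Fin p} (hxy : x ≠ y) :
    |(1 + E)⁻¹ x y| ≤ η * (1 / (1 - η)) := by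
  have h1 : 0 ≤ 1 / (1 - η) := one_div_nonneg.2 (by linarith)
  have := hE.abs_sum_mul_inv_le x y fun z _ => hE.abs_inv_apply_le hη z y
  rw [hE.inv_apply_eq hη, if_neg hxy, zero_sub, abs_neg]
  rwa [max_eq_left h1] at this

/-- Off-diagonal entries of the inverse at positions where the perturbation vanishes are of second order. -/
lemma abs_inv_apply_le_sq (hE : IsSmallSymm η E) (hη : η < 1) {x y : Fin p} (hxy : x ≠ y)
    (h0 : E x y = 0) : |(1 + E)⁻¹ x y| ≤ η ^ 2 * (1 / (1 - η)) := by
  have h1 : 0 ≤ η * (1 / (1 - η)) := mul_nonneg (hE.nonneg x) (one_div_nonneg.2 (by linarith))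
  have := hE.abs_sum_mul_inv_le x y (c := η * (1 / (1 - η))) fun z hz =>
    hE.abs_inv_apply_le_of_ne hη fun h => hz (by rw [h, h0])
  rw [hE.inv_apply_eq hη, if_neg hxy, zero_sub, abs_neg]
  rw [max_eq_left h1] at this
  linarith

lemma inv_apply_self_nonneg (hE : IsSmallSymm η E) (hη : η < 1) (x : Fin p) :
    0 ≤ (1 + E)⁻¹ x x := (hE.posDef_one_add hη).inv.diag_pos.le

lemma inv_symm (hE : IsSmallSymm η E) (hη : η < 1) (x y : Fin p) :
    (1 + E)⁻¹ x y = (1 + E)⁻¹ y x := by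
  have := (hE.posDef_one_add hη).inv.isHermitian.apply x y
  simpa using this.symm

end IsSmallSymm

/-! ### Needle perturbations -/

/-- The symmetric matrix with entries `w j` at `(i, j)` and `(j, i)` for `j ≠ i`, and zeros elsewhere off
the diagonal. The entry at `(i, i)` is `2 * w i`; the needles in use have `w i = 0`. -/
def needle {p : ℕ} (i : Fin p) (w : Fin p → ℝ) : Matrix (Fin p) (Fin p) ℝ :=
  vecMulVec (Pi.single i 1) w + vecMulVec w (Pi.single i 1)

lemma needle_add {p : ℕ} (i : Fin p) (w w' : Fin p → ℝ) :
    needle i (w + w') = needle i w + needle i w' := by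
  simp only [needle, vecMulVec_add, add_vecMulVec]
  abel

/-- The matrix determinant lemma for the rank two perturbation `needle i w`. -/
lemma det_add_smul_needle {p : ℕ} {G : Matrix (Fin p) (Fin p) ℝ} (hG : G.det ≠ 0)
    (hs : ∀ x y, G⁻¹ x y = G⁻¹ y x) (i : Fin p) (w : Fin p → ℝ) (u : ℝ) :
    (G + u • needle i w).det =
      G.det * ((1 + u * (G⁻¹ *ᵥ w) i) ^ 2 - u ^ 2 * G⁻¹ i i * (w ⬝ᵥ G⁻¹ *ᵥ w)) := by
  let U : Matrix (Fin p) (Fin 2) ℝ := of fun x b => if b = 0 then u * (Pi.single i 1 : Fin p → ℝ) x else u * w x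
  let V : Matrix (Fin 2) (Fin p) ℝ := of fun b x => if b = 0 then w x else (Pi.single i 1 : Fin p → ℝ) x
  have hUV : u • needle i w = U * V := by
    ext x y
    simp [needle, U, V, mul_apply, vecMulVec_apply]
    ring
  have hsT : G⁻¹ᵀ = G⁻¹ := by ext x y; exact (hs x y).symm
  have e1 : ∀ v v' : Fin p → ℝ, ∑ y, (∑ x, v x * G⁻¹ x y) * v' y = v ⬝ᵥ G⁻¹ *ᵥ v' := by
    intro v v'
    rw [dotProduct_mulVec]; rfl
  have hent : ∀ a b, (V * G⁻¹ * U) a b = (fun x => V a x) ⬝ᵥ G⁻¹ *ᵥ (fun x => U x b) := by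
    intro a b
    rw [← e1, mul_apply]
    simp only [mul_apply]
  have hw : w ⬝ᵥ G⁻¹ *ᵥ (Pi.single i 1) = (G⁻¹ *ᵥ w) i := by
    rw [dotProduct_mulVec, ← mulVec_transpose, hsT]; simp
  have hU0 : (fun x => U x 0) = u • (Pi.single i 1 : Fin p → ℝ) := by ext; simp [U]
  have hU1 : (fun x => U x 1) = u • w := by ext; simp [U]
  have hV0 : (fun x => V 0 x) = w := by ext; simp [V]
  have hV1 : (fun x => V 1 x) = (Pi.single i 1 : Fin p → ℝ) := by ext; simp [V]
  rw [hUV, det_add_mul _ _ hG.isUnit, det_fin_two]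
  simp only [Matrix.add_apply, hent, hU0, hU1, hV0, hV1, mulVec_smul, dotProduct_smul, hw, smul_eq_mul]
  simp
  left
  ring

/-- The scalar estimate behind the second moment bound. On the left is the product of the relative
determinants of two needle perturbations, on the right that of their sum; the first order terms in
`x` and `y` and the terms `v` and `w` cancel. -/
lemma det_ratio_aux {u η ζ x y v w z : ℝ} (hη : η ≤ 1 / 8) (hu : |u| ≤ η)
    (hζ1 : η ^ 2 ≤ ζ) (hx : |x| ≤ 8 / 7 * (|u| * η)) (hy : |y| ≤ 8 / 7 * (|u| * η))
    (hv0 : 0 ≤ v) (hv : v ≤ 64 / 49 * u ^ 2) (hw0 : 0 ≤ w) (hw : w ≤ 64 / 49 * u ^ 2)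
    (hz : |z| ≤ 64 / 49 * (u ^ 2 * ζ)) (h3 : 1 / 2 ≤ (1 + x + y) ^ 2 - (v + w + 2 * z)) :
    ((1 + x) ^ 2 - v) * ((1 + y) ^ 2 - w) ≤
      (1 + 40 * u ^ 2 * ζ) * ((1 + x + y) ^ 2 - (v + w + 2 * z)) := by
  have hu0 := abs_nonneg u
  have hη0 : 0 ≤ η := hu0.trans hu
  have hq : 0 ≤ u ^ 2 * ζ := mul_nonneg (sq_nonneg _) ((sq_nonneg η).trans hζ1)
  have hqq : u ^ 2 * η ^ 2 ≤ u ^ 2 * ζ := mul_le_mul_of_nonneg_left hζ1 (sq_nonneg _)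
  have hu2 : u ^ 2 ≤ η ^ 2 := by rw [← sq_abs u]; exact pow_le_pow_left₀ hu0 hu 2
  have hxs : |x| ≤ 1 / 56 := by nlinarith
  have hys : |y| ≤ 1 / 56 := by nlinarith
  have hxy : |x * y| ≤ 64 / 49 * (u ^ 2 * ζ) := by
    rw [abs_mul]
    calc |x| * |y| ≤ (8 / 7 * (|u| * η)) * (8 / 7 * (|u| * η)) := by gcongr
      _ = 64 / 49 * (u ^ 2 * η ^ 2) := by rw [← sq_abs u]; ring
      _ ≤ _ := by linarith
  have huy : ∀ y, |y| ≤ 8 / 7 * (|u| * η) → |u ^ 2 * y| ≤ 8 / 7 * (u ^ 2 * ζ) := by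
    intro y hy
    rw [abs_mul, abs_of_nonneg (sq_nonneg u)]
    calc u ^ 2 * |y| ≤ u ^ 2 * (8 / 7 * (η * η)) := by gcongr; exact hy.trans (by gcongr)
      _ = 8 / 7 * (u ^ 2 * η ^ 2) := by ring
      _ ≤ _ := by linarith
  have hvy : ∀ v y, 0 ≤ v → v ≤ 64 / 49 * u ^ 2 → |y| ≤ 8 / 7 * (|u| * η) → |y| ≤ 1 / 56 →
      -(v * ((1 + y) ^ 2 - 1)) ≤ 4 * (u ^ 2 * ζ) := by
    intro v y hv0 hv hy hys
    have h1 := huy y hy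
    rw [abs_mul, abs_of_nonneg (sq_nonneg u)] at h1
    have h2 : -((1 + y) ^ 2 - 1) ≤ 2 * |y| := by nlinarith [neg_abs_le y, sq_nonneg y]
    calc -(v * ((1 + y) ^ 2 - 1)) = v * (-((1 + y) ^ 2 - 1)) := by ring
      _ ≤ v * (2 * |y|) := by gcongr
      _ ≤ (64 / 49 * u ^ 2) * (2 * |y|) := by gcongr
      _ ≤ _ := by nlinarith
  have hvw : v * w ≤ 4 * (u ^ 2 * ζ) := by
    calc v * w ≤ (64 / 49 * u ^ 2) * (64 / 49 * η ^ 2) := by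
          gcongr; exact hw.trans (by gcongr)
      _ ≤ _ := by nlinarith
  have hxy1 : 2 * (x * y) * (1 + x + y) + (x * y) ^ 2 ≤ 5 * (u ^ 2 * ζ) := by
    have e1 : |x * y| ≤ 1 := by
      rw [abs_mul]; nlinarith [abs_nonneg x, abs_nonneg y]
    have e2 : x * y ≤ |x * y| := le_abs_self _
    have e3 : |1 + x + y| ≤ 58 / 56 := by
      rw [abs_le] at *; constructor <;> linarith
    have e4 : 2 * (x * y) * (1 + x + y) ≤ 2 * |x * y| * (58 / 56) := by
      refine (le_abs_self _).trans ?_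
      rw [abs_mul, abs_mul, abs_two]
      gcongr
    have e5 : (x * y) ^ 2 ≤ |x * y| * 1 := by
      rw [← sq_abs, pow_two]; gcongr
    linarith
  have h20 : ((1 + x) ^ 2 - v) * ((1 + y) ^ 2 - w) - ((1 + x + y) ^ 2 - (v + w + 2 * z)) ≤
      20 * (u ^ 2 * ζ) := by
    have := hvy v y hv0 hv hy hys
    have := hvy w x hw0 hw hx hxs
    have := (abs_le.1 hz).2
    nlinarith
  nlinarith

lemma IsSmallSymm.add_smul_needle {p : ℕ} {η : ℝ} {E : Matrix (Fin p) (Fin p) ℝ}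
    (hE : IsSmallSymm η E) (u : ℝ) {i : Fin p} {w : Fin p → ℝ} (hw : w i = 0) :
    IsSmallSymm (η + |u| * ∑ y, |w y|) (E + u • needle i w) where
  symm x y := by
    simp only [Matrix.add_apply, Matrix.smul_apply, needle, vecMulVec_apply, smul_eq_mul,
      hE.symm x y]
    ring
  row_sum x := by
    have h1 : ∑ y, |needle i w x y| ≤ ∑ y, |w y| := by
      simp only [needle, Matrix.add_apply, vecMulVec_apply]
      rcases eq_or_ne x i with rfl | hx
      · simp [hw]
      · have h2 : ∀ y, |(Pi.single i 1 : Fin p → ℝ) x * w y + w x * (Pi.single i 1 : Fin p → ℝ) y| =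
            if y = i then |w x| else 0 := by
          intro y
          by_cases hy : y = i <;> simp [hx, hy]
        simp only [h2, Finset.sum_ite_eq', Finset.mem_univ, if_true]
        exact Finset.single_le_sum (f := fun y => |w y|) (fun y _ => abs_nonneg _)
          (Finset.mem_univ x)
    calc ∑ y, |(E + u • needle i w) x y| ≤ ∑ y, (|E x y| + |u| * |needle i w x y|) := by
          refine Finset.sum_le_sum fun y _ => ?_
          rw [Matrix.add_apply, Matrix.smul_apply, smul_eq_mul, ← abs_mul]
          exact abs_add_le _ _
      _ = ∑ y, |E x y| + |u| * ∑ y, |needle i w x y| := by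
          rw [Finset.sum_add_distrib, Finset.mul_sum]
      _ ≤ _ := add_le_add (hE.row_sum x) (mul_le_mul_of_nonneg_left h1 (abs_nonneg u))

lemma sum_abs_single {p : ℕ} (j : Fin p) : ∑ y, |(Pi.single j 1 : Fin p → ℝ) y| = 1 := by
  simp [Pi.single_apply, apply_ite abs]

lemma IsSmallSymm.add_smul_needle_single {p : ℕ} {η : ℝ} {E : Matrix (Fin p) (Fin p) ℝ}
    (hE : IsSmallSymm η E) (u : ℝ) {i j : Fin p} (hij : i ≠ j) :
    IsSmallSymm (η + |u|) (E + u • needle i (Pi.single j 1)) := by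
  have := hE.add_smul_needle u (w := Pi.single j 1) (i := i) (by simp [hij])
  rwa [sum_abs_single, mul_one] at this

lemma IsSmallSymm.add_smul_needle_pair {p : ℕ} {η : ℝ} {E : Matrix (Fin p) (Fin p) ℝ}
    (hE : IsSmallSymm η E) (u : ℝ) {i j k : Fin p} (hij : i ≠ j) (hik : i ≠ k) :
    IsSmallSymm (η + |u| + |u|) (E + u • needle i (Pi.single j 1 + Pi.single k 1)) := by
  rw [needle_add, smul_add, ← add_assoc]
  exact (hE.add_smul_needle_single u hij).add_smul_needle_single u hik

/-- The contribution of one observation to the mixed second moment of two needle perturbations is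
`1 + O(u² ζ)`. Here `ζ = η²` for two different needles, whose interaction is of second order. -/
lemma sqrt_det_ratio_le {p : ℕ} {η : ℝ} {E : Matrix (Fin p) (Fin p) ℝ} (hE : IsSmallSymm η E)
    (hη : η ≤ 1 / 8) {u : ℝ} (hu : |u| ≤ η) {a : ℝ} (ha : 0 < a) {i j k : Fin p} (hij : i ≠ j)
    (hik : i ≠ k) {ζ : ℝ} (hζ : ζ = 1 ∨ ζ = η ^ 2 ∧ j ≠ k ∧ E j k = 0) :
    √(a • (1 + E + u • needle i (Pi.single j 1))).det *
      √(a • (1 + E + u • needle i (Pi.single k 1))).det /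
      (√(a • (1 + E)).det * √(a • (1 + E + u • needle i (Pi.single j 1 + Pi.single k 1))).det) ≤
      Real.exp (20 * (u ^ 2 * ζ)) := by
  have hη0 : 0 ≤ η := hE.nonneg i
  have hη1 : η < 1 := by linarith
  have hd0 := (hE.posDef_one_add hη1).det_pos
  have h87 : 1 / (1 - η) ≤ 8 / 7 := by
    rw [div_le_div_iff₀ (by linarith) (by norm_num)]; linarith
  have hu2 : u ^ 2 ≤ η ^ 2 := by rw [← sq_abs u]; exact pow_le_pow_left₀ (abs_nonneg u) hu 2
  set S := (1 + E)⁻¹ with hS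
  have hdet := det_add_smul_needle hd0.ne' (hE.inv_symm hη1) i
  simp only [← hS] at hdet
  have hSs : S k j = S j k := hE.inv_symm hη1 k j
  have hmv : ∀ l, (S *ᵥ Pi.single l 1) i = S i l := fun l => by simp
  have hquad : ∀ l l' : Fin p, (Pi.single l 1 : Fin p → ℝ) ⬝ᵥ S *ᵥ Pi.single l' 1 = S l l' :=
    fun l l' => by simp
  have hb : ∀ x y, |S x y| ≤ 8 / 7 := fun x y => (hE.abs_inv_apply_le hη1 x y).trans h87
  have hoff : ∀ l, i ≠ l → |u * S i l| ≤ 8 / 7 * (|u| * η) := by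
    intro l hl
    rw [abs_mul]
    calc |u| * |S i l| ≤ |u| * (η * (1 / (1 - η))) := by
          gcongr; exact hE.abs_inv_apply_le_of_ne hη1 hl
      _ ≤ |u| * (η * (8 / 7)) := by gcongr
      _ = _ := by ring
  have hnn := hE.inv_apply_self_nonneg hη1
  have hprod : ∀ x y l l', |S x y * S l l'| ≤ 64 / 49 := fun x y l l' => by
    rw [abs_mul]
    calc |S x y| * |S l l'| ≤ 8 / 7 * (8 / 7) := by gcongr <;> exact hb _ _
      _ = _ := by norm_num
  have hdiag : ∀ l, u ^ 2 * S i i * S l l ≤ 64 / 49 * u ^ 2 := fun l => by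
    have := (le_abs_self _).trans (hprod i i l l)
    nlinarith [sq_nonneg u]
  have hz : |u ^ 2 * S i i * S j k| ≤ 64 / 49 * (u ^ 2 * ζ) := by
    rw [mul_assoc, abs_mul, abs_of_nonneg (sq_nonneg u)]
    rcases hζ with rfl | ⟨rfl, hjk, h0⟩
    · nlinarith [hprod i i j k, sq_nonneg u]
    · have h1 : |S j k| ≤ η ^ 2 * (8 / 7) :=
        (hE.abs_inv_apply_le_sq hη1 hjk h0).trans (by gcongr)
      rw [abs_mul]
      calc u ^ 2 * (|S i i| * |S j k|) ≤ u ^ 2 * (8 / 7 * (η ^ 2 * (8 / 7))) := by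
            gcongr; exact hb _ _
        _ = _ := by ring
  have hζ1 : η ^ 2 ≤ ζ := by
    rcases hζ with rfl | ⟨rfl, -, -⟩
    · nlinarith
    · exact le_rfl
  have hζ2 : ζ ≤ 1 := by
    rcases hζ with rfl | ⟨rfl, -, -⟩
    · exact le_rfl
    · nlinarith
  have hpd : ∀ w, (1 + E + u • needle i w) = 1 + (E + u • needle i w) := fun w => add_assoc _ _ _
  have e1 := hdet (Pi.single j 1) u
  have e2 := hdet (Pi.single k 1) u
  have e3 := hdet (Pi.single j 1 + Pi.single k 1) u
  rw [hmv, hquad] at e1 e2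
  rw [mulVec_add, Pi.add_apply, hmv, hmv, add_dotProduct, dotProduct_add, dotProduct_add, hquad,
    hquad, hquad, hquad, hSs] at e3
  have hx := hoff j hij
  have hy := hoff k hik
  have hux : |u| * η ≤ 1 / 64 := by nlinarith [abs_nonneg u]
  have hu64 : u ^ 2 ≤ 1 / 64 := by nlinarith
  have h3 : 1 / 2 ≤ (1 + u * S i j + u * S i k) ^ 2 -
      (u ^ 2 * S i i * S j j + u ^ 2 * S i i * S k k + 2 * (u ^ 2 * S i i * S j k)) := by
    have := abs_le.1 hx
    have := abs_le.1 hy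
    have h4 := abs_le.1 hz
    have := hdiag j
    have := hdiag k
    have h5 : u ^ 2 * ζ ≤ 1 / 64 := by nlinarith [sq_nonneg u]
    have h6 : 27 / 28 ≤ 1 + u * S i j + u * S i k := by linarith
    have h7 := pow_le_pow_left₀ (by norm_num) h6 2
    norm_num at h7
    linarith
  have haux := det_ratio_aux hη hu hζ1 hx hy
    (mul_nonneg (mul_nonneg (sq_nonneg u) (hnn i)) (hnn j)) (hdiag j)
    (mul_nonneg (mul_nonneg (sq_nonneg u) (hnn i)) (hnn k)) (hdiag k) hz h3
  simp only [det_smul, Fintype.card_fin]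
  have hap : 0 < a ^ p := pow_pos ha p
  have p1 := ((hE.add_smul_needle_single u hij).posDef_one_add (by linarith)).det_pos
  have p2 := ((hE.add_smul_needle_single u hik).posDef_one_add (by linarith)).det_pos
  have p3 := ((hE.add_smul_needle_pair u hij hik).posDef_one_add (by linarith)).det_pos
  rw [← hpd] at p1 p2 p3
  rw [← Real.sqrt_mul (by positivity), ← Real.sqrt_mul (by positivity), ← Real.sqrt_div (by positivity)]
  have hexp : Real.exp (20 * (u ^ 2 * ζ)) = √(Real.exp (40 * u ^ 2 * ζ)) := by
    rw [← Real.exp_half]; congr 1; ring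
  rw [hexp]
  refine Real.sqrt_le_sqrt ?_
  rw [div_le_iff₀ (by positivity)]
  refine le_trans ?_ (mul_le_mul_of_nonneg_right (Real.add_one_le_exp _) (by positivity))
  have h7 : a ^ p * (1 + E + u • needle i (Pi.single j 1)).det *
      (a ^ p * (1 + E + u • needle i (Pi.single k 1)).det) = (a ^ p * (1 + E).det) ^ 2 *
      (((1 + u * S i j) ^ 2 - u ^ 2 * S i i * S j j) *
        ((1 + u * S i k) ^ 2 - u ^ 2 * S i i * S k k)) := by
    rw [e1, e2]; ring
  have h8 : a ^ p * (1 + E).det *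
      (a ^ p * (1 + E + u • needle i (Pi.single j 1 + Pi.single k 1)).det) =
      (a ^ p * (1 + E).det) ^ 2 * ((1 + u * S i j + u * S i k) ^ 2 -
      (u ^ 2 * S i i * S j j + u ^ 2 * S i i * S k k + 2 * (u ^ 2 * S i i * S j k))) := by
    rw [e3]; ring
  rw [h7, h8, add_comm (40 * u ^ 2 * ζ) 1]
  exact (mul_le_mul_of_nonneg_left haux (sq_nonneg _)).trans (le_of_eq (mul_left_comm _ _ _))

/-- Testing a background precision tuple against the uniform mixture of needle perturbations of it,
with the needle in row `i` at an unknown position `j ∈ A`. The tuple `u` is the vector of needle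
strengths at the sites. -/
lemma needle_testing {M p : ℕ} (n : Fin M → ℕ) (μ : Fin M → EuclideanSpace ℝ (Fin p)) {a : ℝ}
    (ha : 0 < a) {η : ℝ} (hη : η ≤ 1 / 8) {E : MatTuple M p} (hE : ∀ m, IsSmallSymm η (E m))
    {u : Fin M → ℝ} (hu : ∀ m, |u m| ≤ η) {i : Fin p} {A : Finset (Fin p)} (hiA : i ∉ A)
    (h0 : ∀ m, ∀ j ∈ A, ∀ k ∈ A, j ≠ k → E m j k = 0)
    (hτ : ((A.card : ℝ) - 1) * Real.exp (20 * (η ^ 2 * ∑ m, n m * u m ^ 2)) +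
      Real.exp (20 * ∑ m, n m * u m ^ 2) ≤ 2 * A.card)
    {B : Set (Data p n)} (hB : MeasurableSet B) :
    (A.card : ℝ≥0∞) / 2 ≤ ∑ j ∈ A, (dataLaw n μ (fun m => a • (1 + E m)) B +
      dataLaw n μ (fun m => a • (1 + E m + u m • needle i (Pi.single j 1))) Bᶜ) := by
  have hij : ∀ j ∈ A, i ≠ j := fun j hj h => hiA (h ▸ hj)
  have hPD0 : ∀ m, (a • (1 + E m)).PosDef := fun m =>
    ((hE m).posDef_one_add (by linarith)).smul ha
  have hPD1 : ∀ j ∈ A, ∀ m, (a • (1 + E m + u m • needle i (Pi.single j 1))).PosDef := by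
    intro j hj m
    rw [add_assoc]
    exact (((hE m).add_smul_needle_single (u m) (hij j hj)).posDef_one_add
      (by linarith [hu m])).smul ha
  refine half_card_le_sum_errors _ A _
    (fun j => dataRatio n μ (fun m => a • (1 + E m))
      (fun m => a • (1 + E m + u m • needle i (Pi.single j 1))))
    (fun j _ => measurable_dataRatio _ _ _ _)
    (fun j hj => dataLaw_eq_withDensity n μ hPD0 (hPD1 j hj)) ?_ hB
  have hbound : ∀ j ∈ A, ∀ k ∈ A, ∀ ζ : ℝ, (ζ = 1 ∨ ζ = η ^ 2 ∧ j ≠ k) →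
      ∫⁻ x, dataRatio n μ (fun m => a • (1 + E m))
        (fun m => a • (1 + E m + u m • needle i (Pi.single j 1))) x *
        dataRatio n μ (fun m => a • (1 + E m))
        (fun m => a • (1 + E m + u m • needle i (Pi.single k 1))) x
        ∂(dataLaw n μ fun m => a • (1 + E m)) ≤
      ENNReal.ofReal (Real.exp (20 * (ζ * ∑ m, n m * u m ^ 2))) := by
    intro j hj k hk ζ hζ
    rw [lintegral_dataRatio_mul n μ
      (Ω₃ := fun m => a • (1 + E m + u m • needle i (Pi.single j 1 + Pi.single k 1))) hPD0
      (fun m => ?_) (fun m => ?_)]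
    · have hexp : Real.exp (20 * (ζ * ∑ m, n m * u m ^ 2)) =
          ∏ m, Real.exp (20 * (u m ^ 2 * ζ)) ^ n m := by
        simp only [← Real.exp_nat_mul, ← Real.exp_sum, Finset.mul_sum]
        congr 1
        exact Finset.sum_congr rfl fun m _ => by ring
      rw [hexp, ENNReal.ofReal_prod_of_nonneg fun m _ => by positivity]
      refine Finset.prod_le_prod' fun m _ => ?_
      rw [ENNReal.ofReal_pow (Real.exp_pos _).le]
      refine pow_le_pow_left' (ENNReal.ofReal_le_ofReal ?_) _
      exact sqrt_det_ratio_le (hE m) hη (hu m) ha (hij j hj) (hij k hk)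
        (hζ.imp id fun h => ⟨h.1, h.2, h0 m j hj k hk h.2⟩)
    · rw [add_assoc]
      exact (((hE m).add_smul_needle_pair (u m) (hij j hj) (hij k hk)).posDef_one_add
        (by linarith [hu m])).smul ha
    · simp only [needle_add, smul_add]
      abel
  have hsum : ∀ j ∈ A, ∑ k ∈ A, ∫⁻ x, dataRatio n μ (fun m => a • (1 + E m))
        (fun m => a • (1 + E m + u m • needle i (Pi.single j 1))) x *
        dataRatio n μ (fun m => a • (1 + E m))
        (fun m => a • (1 + E m + u m • needle i (Pi.single k 1))) x
        ∂(dataLaw n μ fun m => a • (1 + E m)) ≤ 2 * (A.card : ℝ≥0∞) := by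
    intro j hj
    rw [← Finset.add_sum_erase A _ hj]
    have h1 := hbound j hj j hj 1 (Or.inl rfl)
    have h2 := Finset.sum_le_sum fun k (hk : k ∈ A.erase j) =>
      hbound j hj k (Finset.mem_of_mem_erase hk) (η ^ 2)
        (Or.inr ⟨rfl, (Finset.ne_of_mem_erase hk).symm⟩)
    refine (add_le_add h1 h2).trans ?_
    have hpos : 1 ≤ A.card := Finset.card_pos.2 ⟨j, hj⟩
    rw [Finset.sum_const, nsmul_eq_mul, Finset.card_erase_of_mem hj, one_mul,
      ← ENNReal.ofReal_natCast, ← ENNReal.ofReal_natCast, ← ENNReal.ofReal_ofNat,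
      ← ENNReal.ofReal_mul (by positivity), ← ENNReal.ofReal_mul (by positivity),
      ← ENNReal.ofReal_add (by positivity) (by positivity)]
    refine ENNReal.ofReal_le_ofReal ?_
    rw [Nat.cast_sub hpos, Nat.cast_one]
    linarith
  refine (Finset.sum_le_sum hsum).trans (le_of_eq ?_)
  rw [Finset.sum_const, nsmul_eq_mul]
  ring

/-! ### Lower bounds for the matrix norm and the minimax risk -/

/-- The matrix `l`-norm of a nonnegative matrix dominates the average row sum of every square
submatrix. The bound is free of `l`, because the powers of the size of the block which come from
the row and from the column indicator vector multiply to one. -/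
lemma sum_div_card_le_matNorm (l : ℝ≥0∞) [Fact (1 ≤ l)] {p q : ℕ}
    {A : Matrix (Fin p) (Fin p) ℝ} (hA : ∀ i j, 0 ≤ A i j) {R C : Finset (Fin p)}
    (hR : R.card = q) (hC : C.card = q) (hq : 0 < q) :
    (∑ i ∈ R, ∑ j ∈ C, A i j) / q ≤ matNorm l A := by
  set L := (Matrix.toLpLin l l A).toContinuousLinearMap with hL
  let x : PiLp l fun _ : Fin p => ℝ := WithLp.toLp l fun j => if j ∈ C then 1 else 0
  have hLx : ∀ i, (L x) i = ∑ j ∈ C, A i j := by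
    intro i
    simp [hL, x, toLpLin_apply, mulVec, dotProduct]
  have hop : ‖L x‖ ≤ matNorm l A * ‖x‖ := L.le_opNorm x
  have hs : ∀ i, 0 ≤ ∑ j ∈ C, A i j := fun i => Finset.sum_nonneg fun j _ => hA i j
  have hq' : (0 : ℝ) < q := by exact_mod_cast hq
  have hM0 : 0 ≤ matNorm l A := norm_nonneg _
  rw [div_le_iff₀ hq']
  rcases eq_or_ne l ∞ with rfl | hl
  · have hx : ‖x‖ ≤ 1 := by
      rw [PiLp.norm_eq_ciSup]
      refine Real.iSup_le (fun j => ?_) zero_le_one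
      by_cases hj : j ∈ C <;> simp [x, hj]
    have hLn : ‖L x‖ ≤ matNorm ∞ A := hop.trans (mul_le_of_le_one_right hM0 hx)
    calc ∑ i ∈ R, ∑ j ∈ C, A i j ≤ ∑ i ∈ R, matNorm ∞ A := by
          refine Finset.sum_le_sum fun i _ => ?_
          rw [← hLx i]
          exact (le_abs_self _).trans ((PiLp.norm_apply_le (L x) i).trans hLn)
      _ = _ := by rw [Finset.sum_const, hR, nsmul_eq_mul, mul_comm]
  · have hl1 : 1 ≤ l.toReal := by
      have : (1 : ℝ≥0∞) ≤ l := Fact.out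
      simpa using ENNReal.toReal_mono hl this
    have hl0 : 0 < l.toReal := by linarith
    have hx : ‖x‖ = (q : ℝ) ^ (1 / l.toReal) := by
      rw [PiLp.norm_eq_sum hl0]
      congr 1
      have : ∀ j, ‖x j‖ ^ l.toReal = if j ∈ C then 1 else 0 := by
        intro j
        by_cases hj : j ∈ C <;> simp [x, hj, hl0.ne']
      simp only [this]
      simp [hC]
    have h1 : (∑ i ∈ R, ∑ j ∈ C, A i j) ^ l.toReal ≤ (q : ℝ) ^ (l.toReal - 1) * ‖L x‖ ^ l.toReal := by
      have h2 := Real.rpow_sum_le_const_mul_sum_rpow R (fun i => ∑ j ∈ C, A i j) hl1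
      have e1 : ∑ i ∈ R, |∑ j ∈ C, A i j| = ∑ i ∈ R, ∑ j ∈ C, A i j :=
        Finset.sum_congr rfl fun i _ => abs_of_nonneg (hs i)
      rw [e1, hR] at h2
      refine h2.trans (mul_le_mul_of_nonneg_left ?_ (by positivity))
      rw [PiLp.norm_eq_sum hl0, ← Real.rpow_mul (Finset.sum_nonneg fun i _ => by positivity),
        one_div, inv_mul_cancel₀ hl0.ne', Real.rpow_one]
      refine le_trans (le_of_eq (Finset.sum_congr rfl fun i _ => ?_))
        (Finset.sum_le_sum_of_subset_of_nonneg (Finset.subset_univ R) fun i _ _ => by positivity)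
      rw [hLx, Real.norm_eq_abs]
    have h3 : (∑ i ∈ R, ∑ j ∈ C, A i j) ≤ (q : ℝ) ^ ((l.toReal - 1) / l.toReal) * ‖L x‖ := by
      refine (Real.rpow_le_rpow_iff (Finset.sum_nonneg fun i _ => hs i) (by positivity) hl0).1 ?_
      rw [Real.mul_rpow (by positivity) (norm_nonneg _), ← Real.rpow_mul hq'.le,
        div_mul_cancel₀ _ hl0.ne']
      exact h1
    calc _ ≤ (q : ℝ) ^ ((l.toReal - 1) / l.toReal) * ‖L x‖ := h3
      _ ≤ (q : ℝ) ^ ((l.toReal - 1) / l.toReal) * (matNorm l A * (q : ℝ) ^ (1 / l.toReal)) := by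
          rw [← hx]; gcongr
      _ = matNorm l A * ((q : ℝ) ^ ((l.toReal - 1) / l.toReal) * (q : ℝ) ^ (1 / l.toReal)) := by ring
      _ = matNorm l A * q := by
          rw [← Real.rpow_add hq', ← add_div, sub_add_cancel, div_self hl0.ne', Real.rpow_one]

lemma wnorm₁_nonneg {M : ℕ} (n : Fin M → ℕ) (v : Fin M → ℝ) : 0 ≤ wnorm₁ n v := by
  unfold wnorm₁
  positivity

lemma wnorm₁_le_add {M : ℕ} (n : Fin M → ℕ) (v w : Fin M → ℝ) :
    wnorm₁ n w ≤ wnorm₁ n v + wnorm₁ n (fun m => v m - w m) := by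
  unfold wnorm₁
  rw [← mul_add, ← Finset.sum_add_distrib]
  refine mul_le_mul_of_nonneg_left (Finset.sum_le_sum fun m _ => ?_) (by positivity)
  rw [← mul_add]
  refine mul_le_mul_of_nonneg_left ?_ (by positivity)
  have := abs_sub_abs_le_abs_sub (w m) (v m)
  rw [abs_sub_comm] at this
  linarith

lemma wnorm₁_le_wnorm₂ {M : ℕ} (n : Fin M → ℕ) (v : Fin M → ℝ) : wnorm₁ n v ≤ wnorm₂ n v := by
  unfold wnorm₁ wnorm₂
  refine Real.le_sqrt_of_sq_le ?_
  have h := Finset.sum_mul_sq_le_sq_mul_sq Finset.univ (fun m => √(n m)) (fun m => √(n m) * |v m|)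
  have e1 : ∀ m, √(n m : ℝ) * (√(n m) * |v m|) = n m * |v m| := fun m => by
    rw [← mul_assoc, Real.mul_self_sqrt (by positivity)]
  have e2 : ∀ m, (√(n m : ℝ) * |v m|) ^ 2 = n m * v m ^ 2 := fun m => by
    rw [mul_pow, Real.sq_sqrt (by positivity), sq_abs]
  simp only [e1, e2, Real.sq_sqrt (Nat.cast_nonneg _)] at h
  have e3 : ∑ m, (n m : ℝ) = totalSize n := by simp [totalSize]
  rw [e3] at h
  rcases (Nat.cast_nonneg (α := ℝ) (totalSize n)).eq_or_lt with h0 | h0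
  · simp [← h0]
  · calc _ = (1 / (totalSize n : ℝ)) ^ 2 * (∑ m, (n m : ℝ) * |v m|) ^ 2 := mul_pow _ _ _
      _ ≤ (1 / (totalSize n : ℝ)) ^ 2 * (totalSize n * ∑ m, (n m : ℝ) * v m ^ 2) := by gcongr
      _ = _ := by field_simp

lemma measurable_wnorm₁ {M : ℕ} (n : Fin M → ℕ) {X : Type*} [MeasurableSpace X]
    {f : X → Fin M → ℝ} (hf : ∀ m, Measurable fun x => f x m) :
    Measurable fun x => wnorm₁ n (f x) := by
  unfold wnorm₁
  exact (Finset.measurable_sum _ fun m _ => ((hf m).abs).const_mul _).const_mul _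

/-- Reduction of the minimax risk to a Bayes risk under a uniform prior on finitely many parameters,
where only the entries in a square block are counted. -/
lemma le_minimaxRisk_of_forall (l : ℝ≥0∞) [Fact (1 ≤ l)] {M p : ℕ} (n : Fin M → ℕ)
    (μ : Fin M → EuclideanSpace ℝ (Fin p)) {Cmin Cmax : ℝ} {s₁ s₂ : ℕ} {r : ℝ}
    {loss : MatTuple M p → MatTuple M p → Matrix (Fin p) (Fin p) ℝ}
    (hloss : ∀ A B j k, wnorm₁ n (fun m => A m j k - B m j k) ^ r ≤ loss A B j k)
    {R C : Type*} [Fintype R] [Fintype C] {q : ℕ} (hR : Fintype.card R = q)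
    (hC : Fintype.card C = q) (hq : 0 < q) {ρ : R → Fin p} (hρ : Function.Injective ρ)
    {κ : C → Fin p} (hκ : Function.Injective κ)
    {Θ' : Type*} (T : Finset Θ') (hT : T.Nonempty) (Ω : Θ' → MatTuple M p)
    (hΩ : ∀ θ ∈ T, Ω θ ∈ Theta M p s₁ s₂ ∧ RegularCov Cmin Cmax (Ω θ)) (c : ℝ≥0∞)
    (h : ∀ est : Data p n → MatTuple M p, (∀ m j k, Measurable fun x => est x m j k) →
      (T.card : ℝ≥0∞) * (q * c) ≤ ∑ θ ∈ T, ∑ i, ∑ j, ∫⁻ x, ENNReal.ofReal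
        (wnorm₁ n (fun m => est x m (ρ i) (κ j) - Ω θ m (ρ i) (κ j)) ^ r) ∂(dataLaw n μ (Ω θ))) :
    c ≤ minimaxRisk l n μ Cmin Cmax s₁ s₂ loss := by
  unfold minimaxRisk
  refine le_iInf₂ fun est hest => ?_
  set S := ⨆ Ω ∈ {Ω ∈ Theta M p s₁ s₂ | RegularCov Cmin Cmax Ω},
      ∫⁻ x, ENNReal.ofReal (matNorm l (loss (est x) Ω)) ∂(dataLaw n μ Ω) with hS
  have hq0 : (q : ℝ≥0∞) ≠ 0 := by exact_mod_cast hq.ne'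
  have hT0 : (T.card : ℝ≥0∞) ≠ 0 := by exact_mod_cast hT.card_pos.ne'
  have h1 : ∀ θ ∈ T, ∑ i, ∑ j, ∫⁻ x, ENNReal.ofReal
      (wnorm₁ n (fun m => est x m (ρ i) (κ j) - Ω θ m (ρ i) (κ j)) ^ r) ∂(dataLaw n μ (Ω θ)) ≤
      q * S := by
    intro θ hθ
    have hm : ∀ i j, Measurable fun x => ENNReal.ofReal
        (wnorm₁ n (fun m => est x m (ρ i) (κ j) - Ω θ m (ρ i) (κ j)) ^ r) := fun i j =>
      ((measurable_wnorm₁ n fun m => (hest m _ _).sub_const _).pow_const r).ennreal_ofReal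
    have h2 : ∑ i, ∑ j, ∫⁻ x, ENNReal.ofReal
        (wnorm₁ n (fun m => est x m (ρ i) (κ j) - Ω θ m (ρ i) (κ j)) ^ r) ∂(dataLaw n μ (Ω θ)) =
        ∫⁻ x, ∑ i, ∑ j, ENNReal.ofReal
        (wnorm₁ n (fun m => est x m (ρ i) (κ j) - Ω θ m (ρ i) (κ j)) ^ r) ∂(dataLaw n μ (Ω θ)) := by
      rw [lintegral_finsetSum _ fun i _ => Finset.measurable_sum _ fun j _ => hm i j]
      exact Finset.sum_congr rfl fun i _ => (lintegral_finsetSum _ fun j _ => hm i j).symm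
    have h3 : ∫⁻ x, ENNReal.ofReal (matNorm l (loss (est x) (Ω θ))) ∂(dataLaw n μ (Ω θ)) ≤ S :=
      le_iSup₂ (f := fun Ω (_ : Ω ∈ {Ω ∈ Theta M p s₁ s₂ | RegularCov Cmin Cmax Ω}) =>
        ∫⁻ x, ENNReal.ofReal (matNorm l (loss (est x) Ω)) ∂(dataLaw n μ Ω)) (Ω θ) (hΩ θ hθ)
    rw [h2]
    refine le_trans ?_ (mul_le_mul_right h3 _)
    rw [← lintegral_const_mul' _ _ (ENNReal.natCast_ne_top q)]
    refine lintegral_mono fun x => ?_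
    have hnn : ∀ j k, 0 ≤ loss (est x) (Ω θ) j k := fun j k =>
      (Real.rpow_nonneg (wnorm₁_nonneg _ _) _).trans (hloss _ _ _ _)
    have h4 := sum_div_card_le_matNorm l hnn (R := Finset.univ.map ⟨ρ, hρ⟩)
      (C := Finset.univ.map ⟨κ, hκ⟩) (q := q) (by simpa using hR) (by simpa using hC) hq
    simp only [Finset.sum_map, Function.Embedding.coeFn_mk] at h4
    rw [div_le_iff₀ (by exact_mod_cast hq), mul_comm] at h4
    calc _ = ENNReal.ofReal (∑ i, ∑ j,
          wnorm₁ n (fun m => est x m (ρ i) (κ j) - Ω θ m (ρ i) (κ j)) ^ r) := by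
          rw [ENNReal.ofReal_sum_of_nonneg fun i _ => Finset.sum_nonneg fun j _ =>
            Real.rpow_nonneg (wnorm₁_nonneg _ _) _]
          exact Finset.sum_congr rfl fun i _ => (ENNReal.ofReal_sum_of_nonneg fun j _ =>
            Real.rpow_nonneg (wnorm₁_nonneg _ _) _).symm
      _ ≤ ENNReal.ofReal (q * matNorm l (loss (est x) (Ω θ))) :=
          ENNReal.ofReal_le_ofReal (le_trans (Finset.sum_le_sum fun i _ =>
            Finset.sum_le_sum fun j _ => hloss _ _ _ _) h4)
      _ = _ := by rw [ENNReal.ofReal_mul (Nat.cast_nonneg _), ENNReal.ofReal_natCast]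
  have h5 := (h est hest).trans (Finset.sum_le_sum h1)
  rw [Finset.sum_const, nsmul_eq_mul] at h5
  exact (ENNReal.mul_le_mul_iff_right hq0 (ENNReal.natCast_ne_top q)).1
    ((ENNReal.mul_le_mul_iff_right hT0 (ENNReal.natCast_ne_top _)).1 h5)

/-! ### Averaging over configurations -/

/-- Exchange the value of a function at `ξ` with a separate value. -/
def updateSwap {Ξ V : Type*} [DecidableEq Ξ] (ξ : Ξ) : (Ξ → V) × V ≃ (Ξ → V) × V where
  toFun z := (Function.update z.1 ξ z.2, z.1 ξ)
  invFun z := (Function.update z.1 ξ z.2, z.1 ξ)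
  left_inv z := by simp
  right_inv z := by simp

/-- Resampling the coordinate `ξ` uniformly among its admissible values leaves the uniform
distribution on `Λ` unchanged. -/
lemma sum_resample {Ξ V : Type*} [Fintype Ξ] [DecidableEq Ξ] [Fintype V] [DecidableEq V]
    (Λ : Finset (Ξ → V)) (ξ : Ξ) (G : (Ξ → V) → ℝ≥0∞) :
    ∑ f ∈ Λ, ((Finset.univ.filter fun v => Function.update f ξ v ∈ Λ).card : ℝ≥0∞)⁻¹ *
      ∑ v ∈ Finset.univ.filter fun v => Function.update f ξ v ∈ Λ, G (Function.update f ξ v) =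
    ∑ f ∈ Λ, G f := by
  classical
  set A : (Ξ → V) → Finset V := fun f => Finset.univ.filter fun v => Function.update f ξ v ∈ Λ
    with hA
  have hAu : ∀ f v, A (Function.update f ξ v) = A f := by
    intro f v; simp [hA]
  have hne : ∀ f ∈ Λ, ((A f).card : ℝ≥0∞) ≠ 0 := by
    intro f hf
    have : f ξ ∈ A f := by simp [hA, hf]
    exact_mod_cast (Finset.card_pos.2 ⟨_, this⟩).ne'
  let H : (Ξ → V) × V → ℝ≥0∞ := fun z =>
    if z.1 ∈ Λ ∧ Function.update z.1 ξ z.2 ∈ Λ then ((A z.1).card : ℝ≥0∞)⁻¹ * G z.1 else 0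
  have h1 : ∑ z, H (updateSwap ξ z) = ∑ z, H z := Equiv.sum_comp _ _
  have hl : ∑ z, H (updateSwap ξ z) =
      ∑ f ∈ Λ, ((A f).card : ℝ≥0∞)⁻¹ * ∑ v ∈ A f, G (Function.update f ξ v) := by
    rw [Fintype.sum_prod_type, ← Finset.sum_filter_add_sum_filter_not Finset.univ (· ∈ Λ)]
    rw [Finset.sum_eq_zero (s := Finset.univ.filter (¬ · ∈ Λ)), add_zero, Finset.filter_univ_mem]
    · refine Finset.sum_congr rfl fun f hf => ?_
      rw [Finset.mul_sum, hA, Finset.sum_filter]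
      refine Finset.sum_congr rfl fun v _ => ?_
      simp [H, updateSwap, hf, hAu]
      rfl
    · intro f hf
      rw [Finset.mem_filter] at hf
      exact Finset.sum_eq_zero fun v _ => by simp [H, updateSwap, hf.2]
  have hr : ∑ z, H z = ∑ f ∈ Λ, G f := by
    rw [Fintype.sum_prod_type, ← Finset.sum_filter_add_sum_filter_not Finset.univ (· ∈ Λ)]
    rw [Finset.sum_eq_zero (s := Finset.univ.filter (¬ · ∈ Λ)), add_zero, Finset.filter_univ_mem]
    · refine Finset.sum_congr rfl fun f hf => ?_
      have : ∑ v, H (f, v) = ∑ v ∈ A f, ((A f).card : ℝ≥0∞)⁻¹ * G f := by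
        rw [hA, Finset.sum_filter]
        exact Finset.sum_congr rfl fun v _ => by simp [H, hf, hA]
      rw [this, Finset.sum_const, nsmul_eq_mul, ← mul_assoc,
        ENNReal.mul_inv_cancel (hne f hf) (ENNReal.natCast_ne_top _), one_mul]
    · intro f hf
      rw [Finset.mem_filter] at hf
      exact Finset.sum_eq_zero fun v _ => by simp [H, hf.2]
  rw [← hl, h1, hr]

/-- One coordinate of Assouad's lemma, with mixtures: a configuration consists of on/off bits `γ` and
positions `f`, both uniformly distributed. If, for every fixed value of the remaining coordinates,
the `ξ`-th bit cannot be tested well when the `ξ`-th position is averaged over its admissible values,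
then every test of the `ξ`-th bit errs on average. -/
lemma card_div_four_le_sum_errors {Ξ V X : Type*} [Fintype Ξ] [DecidableEq Ξ] [Fintype V]
    [DecidableEq V] [MeasurableSpace X] (Λ : Finset (Ξ → V))
    (P : (Ξ → Bool) → (Ξ → V) → Measure X) (ξ : Ξ) (B : Set X)
    (H : ∀ γ, ∀ f ∈ Λ, ((Finset.univ.filter fun v => Function.update f ξ v ∈ Λ).card : ℝ≥0∞) / 2 ≤
      ∑ v ∈ Finset.univ.filter fun v => Function.update f ξ v ∈ Λ,
        (P (Function.update γ ξ false) (Function.update f ξ v) B +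
          P (Function.update γ ξ true) (Function.update f ξ v) Bᶜ)) :
    ((Finset.univ ×ˢ Λ : Finset ((Ξ → Bool) × (Ξ → V))).card : ℝ≥0∞) / 4 ≤
      ∑ θ ∈ Finset.univ ×ˢ Λ, P θ.1 θ.2 (if θ.1 ξ then Bᶜ else B) := by
  classical
  set F : (Ξ → Bool) → (Ξ → V) → ℝ≥0∞ := fun γ f => P γ f (if γ ξ then Bᶜ else B) with hF
  have hbool : ∀ f, ∑ γ, F γ f =
      ∑ γ, 2⁻¹ * (F (Function.update γ ξ false) f + F (Function.update γ ξ true) f) := by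
    intro f
    have := sum_resample (Finset.univ : Finset (Ξ → Bool)) ξ fun γ => F γ f
    rw [← this]
    simp [add_comm]
  have hstep : ∀ γ, (Λ.card : ℝ≥0∞) / 2 ≤
      ∑ f ∈ Λ, (F (Function.update γ ξ false) f + F (Function.update γ ξ true) f) := by
    intro γ
    rw [← sum_resample Λ ξ]
    calc (Λ.card : ℝ≥0∞) / 2 = ∑ f ∈ Λ, (2 : ℝ≥0∞)⁻¹ := by
          rw [Finset.sum_const, nsmul_eq_mul, div_eq_mul_inv]
      _ ≤ _ := by
        refine Finset.sum_le_sum fun f hf => ?_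
        have h1 := H γ f hf
        have hne : ((Finset.univ.filter fun v => Function.update f ξ v ∈ Λ).card : ℝ≥0∞) ≠ 0 := by
          have : f ξ ∈ Finset.univ.filter fun v => Function.update f ξ v ∈ Λ := by simp [hf]
          exact_mod_cast (Finset.card_pos.2 ⟨_, this⟩).ne'
        have h2 : ∀ v, F (Function.update γ ξ false) v = P (Function.update γ ξ false) v B :=
          fun v => by simp [hF]
        have h3 : ∀ v, F (Function.update γ ξ true) v = P (Function.update γ ξ true) v Bᶜ :=
          fun v => by simp [hF]
        simp only [h2, h3]
        refine le_trans (le_of_eq ?_) (mul_le_mul_right h1 _)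
        rw [div_eq_mul_inv, ← mul_assoc, ENNReal.inv_mul_cancel hne (ENNReal.natCast_ne_top _),
          one_mul]
  rw [Finset.sum_product_right]
  change _ ≤ ∑ f ∈ Λ, ∑ γ, F γ f
  simp only [hbool]
  rw [Finset.sum_comm]
  simp only [← Finset.mul_sum]
  calc ((Finset.univ ×ˢ Λ : Finset ((Ξ → Bool) × (Ξ → V))).card : ℝ≥0∞) / 4
      = 2⁻¹ * ∑ _γ : Ξ → Bool, (Λ.card : ℝ≥0∞) / 2 := by
        rw [Finset.card_product, Finset.sum_const, nsmul_eq_mul, Nat.cast_mul, div_eq_mul_inv,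
          div_eq_mul_inv, show (4 : ℝ≥0∞) = 2 * 2 by norm_num,
          ENNReal.mul_inv (by simp) (by simp)]
        ring
    _ ≤ _ := by gcongr with γ; exact hstep γ

/-! ### Membership in the parameter space -/

lemma regularCov_of_isSmallSymm {M p : ℕ} {η : ℝ} {E : MatTuple M p}
    (hE : ∀ m, IsSmallSymm η (E m)) (hη : η < 1) {a : ℝ} (ha : 0 < a) {Cmin Cmax : ℝ}
    (hmin : Cmin * (a * (1 + η)) ≤ 1) (hmax : 1 ≤ Cmax * (a * (1 - η))) :
    RegularCov Cmin Cmax fun m => a • (1 + E m) := by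
  intro m
  have hdet := (hE m).det_ne_zero hη
  have hinv : (a • (1 + E m))⁻¹ = a⁻¹ • (1 + E m)⁻¹ := by
    have : Invertible a := invertibleOfNonzero ha.ne'
    rw [inv_smul _ _ hdet.isUnit, invOf_eq_inv]
  refine ⟨fun t ht => ?_, fun j => ?_⟩
  · rw [← spectrum_toLin', ← Module.End.hasEigenvalue_iff_mem_spectrum] at ht
    obtain ⟨v, hv⟩ := ht.exists_hasEigenvector
    have h1 : (a • (1 + E m))⁻¹ *ᵥ v = t • v := by simpa using hv.apply_eq_smul
    have hvv : 0 < v ⬝ᵥ v := by simpa using dotProduct_star_self_pos_iff.2 hv.2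
    have hdeta : (a • (1 + E m)).det ≠ 0 := by
      rw [det_smul]; exact mul_ne_zero (pow_ne_zero _ ha.ne') hdet
    have h2 : v = t • (a • (1 + E m)) *ᵥ v := by
      conv_lhs => rw [← one_mulVec v, ← mul_nonsing_inv _ hdeta.isUnit, ← mulVec_mulVec, h1,
        mulVec_smul]
    have h3 : v ⬝ᵥ v = t * (a * (v ⬝ᵥ v + v ⬝ᵥ E m *ᵥ v)) := by
      calc v ⬝ᵥ v = v ⬝ᵥ (t • (a • (1 + E m)) *ᵥ v) := by rw [← h2]
        _ = _ := by
          rw [smul_mulVec, add_mulVec, one_mulVec, dotProduct_smul, dotProduct_smul,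
            dotProduct_add, smul_eq_mul, smul_eq_mul]
    have h4 := abs_le.1 ((hE m).abs_dotProduct_le v)
    have h5 : 0 < v ⬝ᵥ v + v ⬝ᵥ E m *ᵥ v := by nlinarith
    have h6 : 0 < t := by
      by_contra h
      have : t * (a * (v ⬝ᵥ v + v ⬝ᵥ E m *ᵥ v)) ≤ 0 :=
        mul_nonpos_of_nonpos_of_nonneg (not_lt.1 h) (by positivity)
      linarith
    have h7 : 1 ≤ t * (a * (1 + η)) := by
      have : v ⬝ᵥ v ≤ t * (a * (1 + η)) * (v ⬝ᵥ v) := by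
        conv_lhs => rw [h3]
        have : v ⬝ᵥ v + v ⬝ᵥ E m *ᵥ v ≤ (1 + η) * (v ⬝ᵥ v) := by linarith
        calc t * (a * (v ⬝ᵥ v + v ⬝ᵥ E m *ᵥ v)) ≤ t * (a * ((1 + η) * (v ⬝ᵥ v))) := by gcongr
          _ = _ := by ring
      exact le_of_mul_le_mul_right (by linarith) hvv
    have hη0 : 0 < a * (1 + η) := by
      by_contra h
      nlinarith
    exact le_of_mul_le_mul_right (hmin.trans h7) hη0
  · have hj := (le_abs_self _).trans ((hE m).abs_inv_apply_le hη j j)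
    rw [hinv, Matrix.smul_apply, smul_eq_mul]
    calc a⁻¹ * (1 + E m)⁻¹ j j ≤ a⁻¹ * (1 / (1 - η)) := by gcongr
      _ = 1 / (a * (1 - η)) := by rw [one_div, one_div, mul_inv]
      _ ≤ Cmax := by rwa [div_le_iff₀ (mul_pos ha (by linarith))]

/-- Homogeneous perturbations are in the parameter space; the diagonal entry of a column counts as
one common entry. -/
lemma mem_Theta_of_const {M p s₁ s₂ d : ℕ} {η : ℝ} {E : MatTuple M p} (hM : 0 < M)
    (hE : ∀ m, IsSmallSymm η (E m)) (hη : η < 1) {a : ℝ} (ha : 0 < a)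
    (hconst : ∀ m m', E m = E m') (hd : ∀ k, {x | ∃ m, E m x k ≠ 0}.ncard ≤ d) (hs : d + 1 ≤ s₁) :
    (fun m => a • (1 + E m)) ∈ Theta M p s₁ s₂ := by
  refine ⟨fun m => ((hE m).posDef_one_add hη).smul ha, fun k => ?_, fun k => ?_⟩
  · have hsub : commonSupport (fun m => a • (1 + E m)) k ⊆ insert k {x | ∃ m, E m x k ≠ 0} := by
      intro x hx
      rcases eq_or_ne x k with rfl | hxk
      · exact Set.mem_insert _ _
      · refine Set.mem_insert_of_mem _ ⟨⟨0, hM⟩, fun h => hx.2 ⟨0, hM⟩ ?_⟩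
        simp [hxk, h]
    calc _ ≤ (insert k {x | ∃ m, E m x k ≠ 0}).ncard := Set.ncard_le_ncard hsub (Set.toFinite _)
      _ ≤ _ := Set.ncard_insert_le _ _
      _ ≤ s₁ := by have := hd k; omega
  · have : heteroSupport (fun m => a • (1 + E m)) k = ∅ := by
      ext x
      simp only [heteroSupport, Set.mem_ofPred_eq, Set.mem_empty_iff_false, iff_false, not_not]
      intro m m'
      rw [hconst m m']
    rw [this, Set.ncard_empty]
    exact Nat.zero_le _

/-- If all nonzero entries of the perturbations differ between sites, then only the diagonal entry of
a column is common. -/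
lemma mem_Theta_of_hetero {M p s₁ s₂ d : ℕ} {η : ℝ} {E : MatTuple M p} (hM : 0 < M)
    (hE : ∀ m, IsSmallSymm η (E m)) (hη : η < 1) {a : ℝ} (ha : 0 < a)
    (hhet : ∀ x k, (∃ m, E m x k ≠ 0) → ∃ m m', E m x k ≠ E m' x k)
    (hd : ∀ k, {x | ∃ m, E m x k ≠ 0}.ncard ≤ d) (hs₁ : 1 ≤ s₁) (hs₂ : d ≤ s₂) :
    (fun m => a • (1 + E m)) ∈ Theta M p s₁ s₂ := by
  refine ⟨fun m => ((hE m).posDef_one_add hη).smul ha, fun k => ?_, fun k => ?_⟩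
  · have hsub : commonSupport (fun m => a • (1 + E m)) k ⊆ {k} := by
      intro x hx
      by_contra hxk
      have hxk' : x ≠ k := hxk
      have h1 := hx.2 ⟨0, hM⟩
      obtain ⟨m, m', hmm⟩ := hhet x k ⟨⟨0, hM⟩, fun h => h1 (by simp [hxk', h])⟩
      refine hmm ?_
      have := hx.1 m m'
      simpa [hxk', ha.ne'] using this
    exact (Set.ncard_le_ncard hsub (Set.toFinite _)).trans (by simpa using hs₁)
  · refine (Set.ncard_le_ncard (fun x hx => ?_) (Set.toFinite _)).trans ((hd k).trans hs₂)
    by_contra h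
    refine hx fun m m' => ?_
    simp only [Set.mem_ofPred_eq, not_exists, not_not] at h
    simp [h]

/-! ### Bipartite block perturbations -/

section Block

variable {p : ℕ} {R C D : Type*}

/-- Entries of the symmetric matrix with off-diagonal blocks `B` and `Bᵀ` on the index sets `R` and
`C` and zeros elsewhere. -/
def blockEntry (B : R → C → ℝ) : (R ⊕ C) ⊕ D → (R ⊕ C) ⊕ D → ℝ
  | .inl (.inl i), .inl (.inr j) => B i j
  | .inl (.inr j), .inl (.inl i) => B i j
  | _, _ => 0

/-- The symmetric `p × p` matrix with off-diagonal blocks `B` and `Bᵀ`, for an identification `e` of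
the indices with rows `R` and columns `C` of `B` and a remainder `D`. -/
def blockMat (e : Fin p ≃ (R ⊕ C) ⊕ D) (B : R → C → ℝ) : Matrix (Fin p) (Fin p) ℝ :=
  of fun x y => blockEntry B (e x) (e y)

/-- The matrix index of a row of the block. -/
def rowIdx (e : Fin p ≃ (R ⊕ C) ⊕ D) (i : R) : Fin p := e.symm (.inl (.inl i))

/-- The matrix index of a column of the block. -/
def colIdx (e : Fin p ≃ (R ⊕ C) ⊕ D) (j : C) : Fin p := e.symm (.inl (.inr j))

variable (e : Fin p ≃ (R ⊕ C) ⊕ D)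

lemma rowIdx_injective : Function.Injective (rowIdx e) := fun i i' h => by
  simpa [rowIdx] using h

lemma colIdx_injective : Function.Injective (colIdx e) := fun i i' h => by
  simpa [colIdx] using h

lemma rowIdx_ne_colIdx (i : R) (j : C) : rowIdx e i ≠ colIdx e j := by
  simp [rowIdx, colIdx]

lemma blockMat_row_col (B : R → C → ℝ) (i : R) (j : C) :
    blockMat e B (rowIdx e i) (colIdx e j) = B i j := by
  simp [blockMat, rowIdx, colIdx, blockEntry]

lemma blockMat_col_col (B : R → C → ℝ) (j j' : C) :
    blockMat e B (colIdx e j) (colIdx e j') = 0 := by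
  simp [blockMat, colIdx, blockEntry]

lemma isSmallSymm_blockMat [Fintype R] [Fintype C] [Fintype D] {B : R → C → ℝ} {η : ℝ} (hη : 0 ≤ η)
    (hr : ∀ i, ∑ j, |B i j| ≤ η) (hc : ∀ j, ∑ i, |B i j| ≤ η) : IsSmallSymm η (blockMat e B) where
  symm x y := by
    simp only [blockMat, of_apply]
    rcases e x with (i | j) | d <;> rcases e y with (i' | j') | d' <;> rfl
  row_sum x := by
    simp only [blockMat, of_apply]
    rw [Equiv.sum_comp e fun z => |blockEntry B (e x) z|, Fintype.sum_sum_type,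
      Fintype.sum_sum_type]
    rcases e x with (i | j) | d
    · simpa [blockEntry] using hr i
    · simpa [blockEntry] using hc j
    · simpa [blockEntry] using hη

lemma ncard_support_blockMat_le {M d : ℕ} {B : Fin M → R → C → ℝ} [Finite R] [Finite C]
    (hr : ∀ i, {j | ∃ m, B m i j ≠ 0}.ncard ≤ d) (hc : ∀ j, {i | ∃ m, B m i j ≠ 0}.ncard ≤ d)
    (k : Fin p) : {x | ∃ m, blockMat e (B m) x k ≠ 0}.ncard ≤ d := by
  simp only [blockMat, of_apply]
  rcases hk : e k with (i | j) | z
  · refine le_trans ?_ (hr i)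
    refine (Set.ncard_le_ncard (t := colIdx e '' {j | ∃ m, B m i j ≠ 0}) ?_
      (Set.toFinite _)).trans (Set.ncard_image_le (Set.toFinite _))
    rintro x ⟨m, hm⟩
    rcases hx : e x with (i' | j') | z' <;> rw [hx] at hm
    · exact absurd rfl hm
    · exact ⟨j', ⟨m, hm⟩, by rw [colIdx, ← hx, Equiv.symm_apply_apply]⟩
    · exact absurd rfl hm
  · refine le_trans ?_ (hc j)
    refine (Set.ncard_le_ncard (t := rowIdx e '' {i | ∃ m, B m i j ≠ 0}) ?_
      (Set.toFinite _)).trans (Set.ncard_image_le (Set.toFinite _))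
    rintro x ⟨m, hm⟩
    rcases hx : e x with (i' | j') | z' <;> rw [hx] at hm
    · exact ⟨i', ⟨m, hm⟩, by rw [rowIdx, ← hx, Equiv.symm_apply_apply]⟩
    · exact absurd rfl hm
    · exact absurd rfl hm
  · have : {x | ∃ m, blockEntry (B m) (e x) (.inr z) ≠ 0} = ∅ := by
      ext x
      simp only [Set.mem_ofPred_eq, Set.mem_empty_iff_false, iff_false, not_exists, not_not]
      intro m
      rcases e x with (i' | j') | z' <;> rfl
    simp [this]

lemma exists_ne_blockMat {M : ℕ} {B : Fin M → R → C → ℝ}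
    (h : ∀ i j, (∃ m, B m i j ≠ 0) → ∃ m m', B m i j ≠ B m' i j) (x k : Fin p)
    (hx : ∃ m, blockMat e (B m) x k ≠ 0) :
    ∃ m m', blockMat e (B m) x k ≠ blockMat e (B m') x k := by
  obtain ⟨m, hm⟩ := hx
  simp only [blockMat, of_apply] at hm ⊢
  revert hm
  generalize e x = x'
  generalize e k = k'
  intro hm
  rcases x' with (i | j) | d <;> rcases k' with (i' | j') | d'
  · exact absurd rfl hm
  · exact h i j' ⟨m, hm⟩
  · exact absurd rfl hm
  · exact h i' j ⟨m, hm⟩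
  all_goals exact absurd rfl hm

lemma blockMat_add_single [DecidableEq R] [DecidableEq C] (B : R → C → ℝ) (i : R) (j : C) (u : ℝ) :
    blockMat e (fun i' j' => B i' j' + if i' = i ∧ j' = j then u else 0) =
      blockMat e B + u • needle (rowIdx e i) (Pi.single (colIdx e j) 1) := by
  ext x y
  obtain ⟨x, rfl⟩ := e.symm.surjective x
  obtain ⟨y, rfl⟩ := e.symm.surjective y
  simp only [blockMat, of_apply, Equiv.apply_symm_apply, Matrix.add_apply, Matrix.smul_apply,
    needle, vecMulVec_apply, Pi.single_apply, rowIdx, colIdx, e.symm.injective.eq_iff, smul_eq_mul]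
  rcases x with (x | x) | x <;> rcases y with (y | y) | y <;>
    simp [blockEntry, ite_and, mul_comm]
  all_goals split_ifs <;> rfl

end Block

/-! ### Needles at unknown positions -/

section Needles

variable {M b k : ℕ}

/-- The off-diagonal blocks of a needle configuration. The rows of the block are `Fin b × Fin k`, its
columns fall into `k` groups of size `b`, and row `i` has a needle in group `h` at position
`f (i, h)`, present if `γ (i, h)` holds. The vector `u` contains its values at the sites. -/
def needleBlock (u : Fin M → ℝ) (γ : (Fin b × Fin k) × Fin k → Bool)
    (f : (Fin b × Fin k) × Fin k → Fin b) (m : Fin M) (i : Fin b × Fin k) (c : Fin k × Fin b) : ℝ :=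
  if γ (i, c.1) = true ∧ f (i, c.1) = c.2 then u m else 0

/-- Position assignments with at most `K` needles in every column. -/
def admissible (b k K : ℕ) : Finset ((Fin b × Fin k) × Fin k → Fin b) :=
  Finset.univ.filter fun f => ∀ h v, (Finset.univ.filter fun i => f (i, h) = v).card ≤ K

lemma admissible_nonempty {K : ℕ} (hK : k ≤ K) : (admissible b k K).Nonempty := by
  refine ⟨fun z => z.1.1, ?_⟩
  simp only [admissible, Finset.mem_filter, Finset.mem_univ, true_and]
  intro h v
  have : (Finset.univ.filter fun i : Fin b × Fin k => i.1 = v) ⊆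
      Finset.univ.image fun j : Fin k => (v, j) := by
    rintro ⟨x, y⟩ hx
    exact Finset.mem_image.2 ⟨y, Finset.mem_univ _, Prod.ext (Finset.mem_filter.1 hx).2.symm rfl⟩
  refine (Finset.card_le_card this).trans (Finset.card_image_le.trans ?_)
  simpa using hK

/-- At most half of the columns of a group are full, so at least half of the positions are
admissible for any one needle. -/
lemma le_two_mul_card_admissible {K : ℕ} (hk : 0 < k) (hK : 2 * k ≤ K)
    {f : (Fin b × Fin k) × Fin k → Fin b} (hf : f ∈ admissible b k K)
    (ξ : (Fin b × Fin k) × Fin k) :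
    b ≤ 2 * (Finset.univ.filter fun v => Function.update f ξ v ∈ admissible b k K).card := by
  obtain ⟨i, h⟩ := ξ
  simp only [admissible, Finset.mem_filter, Finset.mem_univ, true_and] at hf
  have hbad : ∀ v, Function.update f (i, h) v ∉ admissible b k K →
      K ≤ (Finset.univ.filter fun i' => f (i', h) = v).card := by
    intro v hv
    simp only [admissible, Finset.mem_filter, Finset.mem_univ, true_and, not_forall, not_le] at hv
    obtain ⟨h', v', hv'⟩ := hv
    have hsub : (Finset.univ.filter fun i' => Function.update f (i, h) v (i', h') = v') ⊆
        insert i (Finset.univ.filter fun i' => f (i', h') = v') := by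
      intro i' hi'
      simp only [Finset.mem_filter, Finset.mem_univ, true_and, Finset.mem_insert] at hi' ⊢
      rcases eq_or_ne i' i with hii | hii
      · exact Or.inl hii
      · right; rwa [Function.update_of_ne (by simp [hii])] at hi'
    have h2 := hv'.trans_le ((Finset.card_le_card hsub).trans (Finset.card_insert_le _ _))
    rcases eq_or_ne h' h with rfl | hh
    · rcases eq_or_ne v' v with rfl | hvv
      · omega
      · exfalso
        have hsub' : (Finset.univ.filter fun i' => Function.update f (i, h') v (i', h') = v') ⊆
            (Finset.univ.filter fun i' => f (i', h') = v') := by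
          intro i' hi'
          simp only [Finset.mem_filter, Finset.mem_univ, true_and] at hi' ⊢
          rcases eq_or_ne i' i with rfl | hii
          · rw [Function.update_self] at hi'; exact absurd hi'.symm hvv
          · rwa [Function.update_of_ne (by simp [hii])] at hi'
        have := (Finset.card_le_card hsub').trans (hf h' v')
        omega
    · exfalso
      have heq : (Finset.univ.filter fun i' => Function.update f (i, h) v (i', h') = v') =
          (Finset.univ.filter fun i' => f (i', h') = v') := by
        ext i'
        simp [Function.update_of_ne (show (i', h') ≠ (i, h) by simp [hh])]
      rw [heq] at hv'
      have := hf h' v'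
      omega
  have htot : ∑ v, (Finset.univ.filter fun i' => f (i', h) = v).card = b * k := by
    have := Finset.card_eq_sum_card_fiberwise (f := fun i' => f (i', h))
      (s := (Finset.univ : Finset (Fin b × Fin k))) (t := Finset.univ) (by simp)
    rw [← this]
    simp
  have hle : (Finset.univ.filter fun v => ¬ Function.update f (i, h) v ∈ admissible b k K).card * K ≤
      b * k := by
    rw [← htot]
    calc _ = ∑ v ∈ Finset.univ.filter fun v => ¬ Function.update f (i, h) v ∈ admissible b k K, K := by
          rw [Finset.sum_const, smul_eq_mul]
      _ ≤ ∑ v ∈ Finset.univ.filter fun v => ¬ Function.update f (i, h) v ∈ admissible b k K,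
          (Finset.univ.filter fun i' => f (i', h) = v).card :=
          Finset.sum_le_sum fun v hv => hbad v (Finset.mem_filter.1 hv).2
      _ ≤ _ := Finset.sum_le_sum_of_subset (Finset.subset_univ _)
  have hcard := Finset.card_filter_add_card_filter_not (s := (Finset.univ : Finset (Fin b)))
    (fun v => Function.update f (i, h) v ∈ admissible b k K)
  rw [Finset.card_univ, Fintype.card_fin] at hcard
  have h3 : 2 * (Finset.univ.filter fun v =>
      ¬ Function.update f (i, h) v ∈ admissible b k K).card ≤ b := by
    refine Nat.le_of_mul_le_mul_right (c := k) ?_ hk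
    calc _ = (Finset.univ.filter fun v =>
          ¬ Function.update f (i, h) v ∈ admissible b k K).card * (2 * k) := by ring
      _ ≤ _ := (Nat.mul_le_mul_left _ hK).trans hle
  omega

variable {p : ℕ} {D : Type*}
  (e : Fin p ≃ ((Fin b × Fin k) ⊕ (Fin k × Fin b)) ⊕ D)

lemma needleBlock_update (u : Fin M → ℝ) (γ : (Fin b × Fin k) × Fin k → Bool)
    (f : (Fin b × Fin k) × Fin k → Fin b) (i : Fin b × Fin k) (h : Fin k) (v : Fin b) (m : Fin M) :
    blockMat e (needleBlock u (Function.update γ (i, h) true) (Function.update f (i, h) v) m) =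
      blockMat e (needleBlock u (Function.update γ (i, h) false) f m) +
        u m • needle (rowIdx e i) (Pi.single (colIdx e (h, v)) 1) := by
  rw [← blockMat_add_single]
  congr 1
  ext i' ⟨h', v'⟩
  rcases eq_or_ne (i', h') (i, h) with hi | hi
  · obtain ⟨rfl, rfl⟩ := Prod.mk.inj hi
    simp [needleBlock, eq_comm]
  · have : ¬ (i' = i ∧ (h', v') = (h, v)) := fun hh => hi (by
      rw [hh.1, (Prod.mk.inj hh.2).1])
    rw [if_neg this, add_zero]
    simp [needleBlock, Function.update_of_ne hi]

lemma needleBlock_update_false (u : Fin M → ℝ) (γ : (Fin b × Fin k) × Fin k → Bool)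
    (f : (Fin b × Fin k) × Fin k → Fin b) (ξ : (Fin b × Fin k) × Fin k) (v : Fin b) :
    needleBlock u (Function.update γ ξ false) (Function.update f ξ v) =
      needleBlock u (Function.update γ ξ false) f := by
  ext m i c
  rcases eq_or_ne (i, c.1) ξ with hi | hi
  · simp [needleBlock, hi]
  · simp [needleBlock, Function.update_of_ne hi]

lemma isSmallSymm_needleBlock [Fintype D] {K : ℕ} (hK : k ≤ K) {u : Fin M → ℝ} {η : ℝ} {m : Fin M}
    (hu : K * |u m| ≤ η) (γ : (Fin b × Fin k) × Fin k → Bool)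
    {f : (Fin b × Fin k) × Fin k → Fin b} (hf : f ∈ admissible b k K) :
    IsSmallSymm η (blockMat e (needleBlock u γ f m)) := by
  have hle : ∀ i c, |needleBlock u γ f m i c| ≤ if f (i, c.1) = c.2 then |u m| else 0 := by
    intro i c
    unfold needleBlock
    by_cases h1 : f (i, c.1) = c.2 <;> by_cases h2 : γ (i, c.1) = true <;> simp [h1, h2]
  have hη : 0 ≤ η := le_trans (by positivity) hu
  refine isSmallSymm_blockMat e hη (fun i => ?_) (fun c => ?_)
  · refine (Finset.sum_le_sum fun c _ => hle i c).trans ?_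
    rw [Fintype.sum_prod_type]
    simp only [Finset.sum_ite_eq, Finset.mem_univ, if_true, Finset.sum_const, Finset.card_univ,
      Fintype.card_fin, nsmul_eq_mul]
    refine le_trans ?_ hu
    gcongr
  · refine (Finset.sum_le_sum fun i _ => hle i c).trans ?_
    rw [← Finset.sum_filter, Finset.sum_const, nsmul_eq_mul]
    refine le_trans ?_ hu
    have := (Finset.mem_filter.1 hf).2 c.1 c.2
    gcongr

lemma ncard_needleBlock_le {K : ℕ} (hK : k ≤ K) (u : Fin M → ℝ)
    (γ : (Fin b × Fin k) × Fin k → Bool)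
    {f : (Fin b × Fin k) × Fin k → Fin b} (hf : f ∈ admissible b k K) (y : Fin p) :
    {x | ∃ m, blockMat e (needleBlock u γ f m) x y ≠ 0}.ncard ≤ K := by
  refine ncard_support_blockMat_le e (fun i => ?_) (fun c => ?_) y
  · have hsub : {c | ∃ m, needleBlock u γ f m i c ≠ 0} ⊆ Set.range fun h => (h, f (i, h)) := by
      rintro ⟨h, v⟩ ⟨m, hm⟩
      refine ⟨h, ?_⟩
      by_contra hne
      exact hm (if_neg fun hh => hne (Prod.ext rfl hh.2))
    calc _ ≤ (Set.range fun h => (h, f (i, h))).ncard := Set.ncard_le_ncard hsub (Set.toFinite _)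
      _ ≤ k := by
        rw [← Set.image_univ]
        refine (Set.ncard_image_le (Set.toFinite _)).trans ?_
        rw [Set.ncard_univ, Nat.card_eq_fintype_card, Fintype.card_fin]
      _ ≤ K := hK
  · refine le_trans ?_ ((Finset.mem_filter.1 hf).2 c.1 c.2)
    rw [← Set.ncard_coe_finset]
    refine Set.ncard_le_ncard ?_ (Set.toFinite _)
    rintro i ⟨m, hm⟩
    rw [Finset.mem_coe, Finset.mem_filter]
    refine ⟨Finset.mem_univ _, ?_⟩
    by_contra hne
    exact hm (if_neg fun hh => hne hh.2)

end Needles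

lemma exists_equiv_block {p : ℕ} {R C : Type*} [Fintype R] [Fintype C]
    (h : Fintype.card R + Fintype.card C ≤ p) :
    Nonempty (Fin p ≃ (R ⊕ C) ⊕ Fin (p - (Fintype.card R + Fintype.card C))) := by
  refine ⟨Fintype.equivOfCardEq ?_⟩
  simp only [Fintype.card_fin, Fintype.card_sum]
  omega

/-- A Bayes risk bound for needles at unknown positions: the total loss over one group of entries in
one row is at least `(ω / 2) ^ r` whenever the presence of the needle is guessed wrongly by
thresholding the estimated entries. -/
lemma needle_lower_bound (l : ℝ≥0∞) [Fact (1 ≤ l)] {M p : ℕ} (hM : 0 < M) (n : Fin M → ℕ)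
    (μ : Fin M → EuclideanSpace ℝ (Fin p)) {Cmin Cmax : ℝ} {s₁ s₂ : ℕ} {r : ℝ} (hr : 0 ≤ r)
    {loss : MatTuple M p → MatTuple M p → Matrix (Fin p) (Fin p) ℝ}
    (hloss : ∀ A B j k, wnorm₁ n (fun m => A m j k - B m j k) ^ r ≤ loss A B j k)
    {b k K : ℕ} (hb : 0 < b) (hk : 0 < k) (hkK : 2 * k ≤ K) (hp : b * k + k * b ≤ p)
    {a : ℝ} (ha : 0 < a) {η : ℝ} (hη : η ≤ 1 / 8)
    (hmin : Cmin * (a * (1 + η)) ≤ 1) (hmax : 1 ≤ Cmax * (a * (1 - η)))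
    {u : Fin M → ℝ} (hu : ∀ m, K * |u m| ≤ η)
    (hΘ : (∀ m m', u m = u m') ∧ K + 1 ≤ s₁ ∨ (∃ m m', u m ≠ u m') ∧ K ≤ s₂ ∧ 1 ≤ s₁)
    (hτ₁ : Real.exp (20 * (η ^ 2 * ∑ m, n m * u m ^ 2)) ≤ 3 / 2)
    (hτ₂ : 4 * Real.exp (20 * ∑ m, n m * u m ^ 2) ≤ b) :
    ENNReal.ofReal (k * (wnorm₁ n (fun m => a * u m) / 2) ^ r / 4) ≤
      minimaxRisk l n μ Cmin Cmax s₁ s₂ loss := by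
  obtain ⟨e⟩ := exists_equiv_block (p := p) (R := Fin b × Fin k) (C := Fin k × Fin b) (by simpa using hp)
  have hη1 : η < 1 := by linarith
  have hkK' : k ≤ K := by omega
  set ω := wnorm₁ n (fun m => a * u m) with hω
  have hω0 : 0 ≤ ω := wnorm₁_nonneg _ _
  let Ω : (((Fin b × Fin k) × Fin k → Bool) × ((Fin b × Fin k) × Fin k → Fin b)) → MatTuple M p :=
    fun θ m => a • (1 + blockMat e (needleBlock u θ.1 θ.2 m))
  have hsmall : ∀ γ, ∀ f ∈ admissible b k K, ∀ m,
      IsSmallSymm η (blockMat e (needleBlock u γ f m)) := fun γ f hf m =>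
    isSmallSymm_needleBlock e hkK' (hu m) γ hf
  have hΩrc : ∀ θ m i c, Ω θ m (rowIdx e i) (colIdx e c) = a * needleBlock u θ.1 θ.2 m i c := by
    intro θ m i c
    simp [Ω, blockMat_row_col, rowIdx_ne_colIdx]
  refine le_minimaxRisk_of_forall l n μ hloss (R := Fin b × Fin k) (C := Fin k × Fin b) (q := b * k)
    (by simp) (by simp [mul_comm]) (by positivity) (rowIdx_injective e) (colIdx_injective e)
    (Finset.univ ×ˢ admissible b k K)
    (Finset.univ_nonempty.product (admissible_nonempty hkK')) Ω (fun θ hθ => ?_) _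
    fun est hest => ?_
  · have hf := (Finset.mem_product.1 hθ).2
    refine ⟨?_, regularCov_of_isSmallSymm (hsmall θ.1 _ hf) hη1 ha hmin hmax⟩
    rcases hΘ with ⟨hc, hs⟩ | ⟨⟨m, m', hmm⟩, hs, hs₁⟩
    · refine mem_Theta_of_const hM (hsmall θ.1 _ hf) hη1 ha (fun m m' => ?_)
        (ncard_needleBlock_le e hkK' u θ.1 hf) hs
      congr 1
      ext i c
      simp [needleBlock, hc m m']
    · refine mem_Theta_of_hetero hM (hsmall θ.1 _ hf) hη1 ha (exists_ne_blockMat e ?_)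
        (ncard_needleBlock_le e hkK' u θ.1 hf) hs₁ hs
      rintro i c ⟨m₀, hm₀⟩
      refine ⟨m, m', ?_⟩
      by_cases hc : θ.1 (i, c.1) = true ∧ θ.2 (i, c.1) = c.2
      · simpa [needleBlock, hc] using hmm
      · exact absurd (if_neg hc) hm₀
  · -- the test for the presence of the needle in row `ξ.1` and group `ξ.2`
    let B : (Fin b × Fin k) × Fin k → Set (Data p n) := fun ξ =>
      ⋃ v, {x | ω / 2 < wnorm₁ n fun m => est x m (rowIdx e ξ.1) (colIdx e (ξ.2, v))}
    have hBm : ∀ ξ, MeasurableSet (B ξ) := fun ξ => MeasurableSet.iUnion fun v =>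
      measurableSet_lt measurable_const (measurable_wnorm₁ n fun m => hest m _ _)
    set T : Finset (((Fin b × Fin k) × Fin k → Bool) × ((Fin b × Fin k) × Fin k → Fin b)) :=
      Finset.univ ×ˢ admissible b k K with hT
    have hassouad : ∀ ξ : (Fin b × Fin k) × Fin k, (T.card : ℝ≥0∞) / 4 ≤
        ∑ θ ∈ T, dataLaw n μ (Ω θ) (if θ.1 ξ then (B ξ)ᶜ else B ξ) := by
      rintro ⟨i, h⟩
      refine card_div_four_le_sum_errors (admissible b k K) (fun γ f => dataLaw n μ (Ω (γ, f)))
        (i, h) (B (i, h)) fun γ f hf => ?_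
      set A := Finset.univ.filter fun v => Function.update f (i, h) v ∈ admissible b k K with hA
      have hAcard : (b : ℝ) ≤ 2 * A.card := by
        exact_mod_cast le_two_mul_card_admissible hk hkK hf (i, h)
      have hinj : Function.Injective fun v => colIdx e (h, v) := fun v v' hv => by
        simpa using colIdx_injective e hv
      have htest := needle_testing n μ ha hη
        (E := fun m => blockMat e (needleBlock u (Function.update γ (i, h) false) f m))
        (hsmall _ f hf) (u := u) (i := rowIdx e i) (A := A.map ⟨_, hinj⟩) (fun m => ?_) ?_ ?_ ?_
        (hBm (i, h))
      · rw [Finset.card_map, Finset.sum_map] at htest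
        refine htest.trans (le_of_eq (Finset.sum_congr rfl fun v _ => ?_))
        simp only [Ω, needleBlock_update_false, needleBlock_update, Function.Embedding.coeFn_mk,
          add_assoc]
      · refine le_trans ?_ (hu m)
        have : (1 : ℝ) ≤ K := by exact_mod_cast (by omega : 1 ≤ K)
        nlinarith [abs_nonneg (u m)]
      · simp only [Finset.mem_map, Function.Embedding.coeFn_mk, not_exists, not_and]
        exact fun v _ hv => rowIdx_ne_colIdx e i (h, v) hv.symm
      · intro m j hj j' hj' _
        obtain ⟨v, -, rfl⟩ := Finset.mem_map.1 hj
        obtain ⟨v', -, rfl⟩ := Finset.mem_map.1 hj'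
        exact blockMat_col_col _ _ _ _
      · rw [Finset.card_map]
        have hA1 : (1 : ℝ) ≤ A.card := by
          have : 0 < A.card := by
            by_contra h0
            have h00 : A.card = 0 := by omega
            rw [h00] at hAcard
            have : (0 : ℝ) < b := by exact_mod_cast hb
            simp at hAcard
            omega
          exact_mod_cast this
        nlinarith
    have hpt : ∀ θ (ξ : (Fin b × Fin k) × Fin k), ENNReal.ofReal ((ω / 2) ^ r) *
        dataLaw n μ (Ω θ) (if θ.1 ξ then (B ξ)ᶜ else B ξ) ≤
        ∑ v, ∫⁻ x, ENNReal.ofReal (wnorm₁ n (fun m => est x m (rowIdx e ξ.1) (colIdx e (ξ.2, v)) -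
          Ω θ m (rowIdx e ξ.1) (colIdx e (ξ.2, v))) ^ r) ∂(dataLaw n μ (Ω θ)) := by
      intro θ ξ
      have hm : ∀ v, Measurable fun x => ENNReal.ofReal
          (wnorm₁ n (fun m => est x m (rowIdx e ξ.1) (colIdx e (ξ.2, v)) -
          Ω θ m (rowIdx e ξ.1) (colIdx e (ξ.2, v))) ^ r) := fun v =>
        ((measurable_wnorm₁ n fun m => (hest m _ _).sub_const _).pow_const r).ennreal_ofReal
      have hSm : MeasurableSet (if θ.1 ξ then (B ξ)ᶜ else B ξ) := by
        split_ifs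
        · exact (hBm ξ).compl
        · exact hBm ξ
      rw [← lintegral_finsetSum _ fun v _ => hm v, ← setLIntegral_const]
      refine le_trans (setLIntegral_mono' hSm fun x hx => ?_) (setLIntegral_le_lintegral _ _)
      have hex : ∃ v, ω / 2 ≤ wnorm₁ n (fun m => est x m (rowIdx e ξ.1) (colIdx e (ξ.2, v)) -
          Ω θ m (rowIdx e ξ.1) (colIdx e (ξ.2, v))) := by
        by_cases hγ : θ.1 ξ = true
        · refine ⟨θ.2 ξ, ?_⟩
          rw [if_pos hγ] at hx
          have hx' : ¬ ω / 2 < wnorm₁ n fun m => est x m (rowIdx e ξ.1) (colIdx e (ξ.2, θ.2 ξ)) :=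
            fun h => hx (Set.mem_iUnion.2 ⟨_, h⟩)
          have htri := wnorm₁_le_add n (fun m => est x m (rowIdx e ξ.1) (colIdx e (ξ.2, θ.2 ξ)))
            (fun m => a * u m)
          have hval : ∀ m, Ω θ m (rowIdx e ξ.1) (colIdx e (ξ.2, θ.2 ξ)) = a * u m := fun m => by
            rw [hΩrc]; simp [needleBlock, hγ]
          simp only [hval]
          linarith
        · rw [if_neg hγ] at hx
          obtain ⟨v, hv⟩ := Set.mem_iUnion.1 hx
          refine ⟨v, ?_⟩
          have hval : ∀ m, Ω θ m (rowIdx e ξ.1) (colIdx e (ξ.2, v)) = 0 := fun m => by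
            rw [hΩrc]; simp [needleBlock, hγ]
          simp only [hval, sub_zero]
          exact le_of_lt hv
      obtain ⟨v, hv⟩ := hex
      refine le_trans (ENNReal.ofReal_le_ofReal (Real.rpow_le_rpow (by positivity) hv hr)) ?_
      exact Finset.single_le_sum (f := fun v => ENNReal.ofReal
          (wnorm₁ n (fun m => est x m (rowIdx e ξ.1) (colIdx e (ξ.2, v)) -
          Ω θ m (rowIdx e ξ.1) (colIdx e (ξ.2, v))) ^ r)) (fun _ _ => zero_le) (Finset.mem_univ v)
    calc (T.card : ℝ≥0∞) * (((b * k : ℕ) : ℝ≥0∞) * ENNReal.ofReal (k * (ω / 2) ^ r / 4))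
        = ∑ _ξ : (Fin b × Fin k) × Fin k, ENNReal.ofReal ((ω / 2) ^ r) * ((T.card : ℝ≥0∞) / 4) := by
          rw [Finset.sum_const, Finset.card_univ, nsmul_eq_mul, mul_div_right_comm,
            ENNReal.ofReal_mul (by positivity), ENNReal.ofReal_div_of_pos (by norm_num)]
          simp only [Fintype.card_prod, Fintype.card_fin, ENNReal.ofReal_natCast, Nat.cast_mul,
            ENNReal.ofReal_ofNat, div_eq_mul_inv]
          ring
      _ ≤ ∑ ξ : (Fin b × Fin k) × Fin k, ∑ θ ∈ T, ENNReal.ofReal ((ω / 2) ^ r) *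
          dataLaw n μ (Ω θ) (if θ.1 ξ then (B ξ)ᶜ else B ξ) := by
          refine Finset.sum_le_sum fun ξ _ => ?_
          rw [← Finset.mul_sum]
          exact mul_le_mul_right (hassouad ξ) _
      _ = ∑ θ ∈ T, ∑ i : Fin b × Fin k, ∑ h : Fin k, ENNReal.ofReal ((ω / 2) ^ r) *
          dataLaw n μ (Ω θ) (if θ.1 (i, h) then (B (i, h))ᶜ else B (i, h)) := by
          rw [Finset.sum_comm]
          exact Finset.sum_congr rfl fun θ _ => Fintype.sum_prod_type _
      _ ≤ _ := by
          refine Finset.sum_le_sum fun θ _ => Finset.sum_le_sum fun i _ => ?_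
          rw [Fintype.sum_prod_type]
          exact Finset.sum_le_sum fun h _ => hpt θ (i, h)

/-! ### Independent bits at all sites -/

/-- The off-diagonal block with one bit per entry and site. If `u m₀` is the largest `u m`, then the
shift by `2` at the site `m₀` separates its entries from those of the other sites, so that all entries
of the block are heterogeneous. -/
def bitBlock {M q : ℕ} (m₀ : Fin M) (u : Fin M → ℝ) (γ : (Fin q × Fin q) × Fin M → Bool)
    (m : Fin M) (i j : Fin q) : ℝ :=
  u m * ((if m = m₀ then 2 else 0) + if γ ((i, j), m) then 1 else 0)

lemma bitBlock_update {M p q : ℕ} {D : Type*} (e : Fin p ≃ (Fin q ⊕ Fin q) ⊕ D) (m₀ : Fin M)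
    (u : Fin M → ℝ) (γ : (Fin q × Fin q) × Fin M → Bool) (i j : Fin q) (m m' : Fin M) :
    blockMat e (bitBlock m₀ u (Function.update γ ((i, j), m) true) m') =
      blockMat e (bitBlock m₀ u (Function.update γ ((i, j), m) false) m') +
        (if m' = m then u m else 0) • needle (rowIdx e i) (Pi.single (colIdx e j) 1) := by
  rw [← blockMat_add_single]
  congr 1
  ext i' j'
  rcases eq_or_ne ((i', j'), m') ((i, j), m) with h | h
  · obtain ⟨h1, rfl⟩ := Prod.mk.inj h
    obtain ⟨rfl, rfl⟩ := Prod.mk.inj h1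
    simp [bitBlock, mul_add]
  · have hif : (if i' = i ∧ j' = j then (if m' = m then u m else 0) else 0) = 0 := by
      split_ifs with h1 h2
      · exact absurd (by rw [h1.1, h1.2, h2]) h
      · rfl
      · rfl
    rw [hif, add_zero]
    simp [bitBlock, Function.update_of_ne h]

/-- A Bayes risk bound for site-specific entries: no bit can be learned from the data of its site, and
the other sites carry no information about it. -/
lemma bit_lower_bound (l : ℝ≥0∞) [Fact (1 ≤ l)] {M p : ℕ} (hM : 2 ≤ M) (n : Fin M → ℕ)
    (μ : Fin M → EuclideanSpace ℝ (Fin p)) {Cmin Cmax : ℝ} {s₁ q : ℕ} {r : ℝ} (hr : 1 ≤ r)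
    {loss : MatTuple M p → MatTuple M p → Matrix (Fin p) (Fin p) ℝ}
    (hloss : ∀ A B j k, wnorm₁ n (fun m => A m j k - B m j k) ^ r ≤ loss A B j k)
    (hq : 0 < q) (hp : q + q ≤ p) (hs₁ : 1 ≤ s₁)
    {a : ℝ} (ha : 0 < a) {η : ℝ} (hη : η ≤ 1 / 8)
    (hmin : Cmin * (a * (1 + η)) ≤ 1) (hmax : 1 ≤ Cmax * (a * (1 - η)))
    {u : Fin M → ℝ} (hu0 : ∀ m, 0 < u m) {m₀ : Fin M} (hm₀ : ∀ m, u m ≤ u m₀)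
    (hu : q * (3 * u m₀) ≤ η) (hτ : ∀ m, Real.exp (20 * (n m * u m ^ 2)) ≤ 2)
    (hω : 0 < wnorm₁ n fun m => a * u m) :
    ENNReal.ofReal (q * (wnorm₁ n (fun m => a * u m) / 16) ^ r) ≤
      minimaxRisk l n μ Cmin Cmax s₁ q loss := by
  obtain ⟨e⟩ := exists_equiv_block (p := p) (R := Fin q) (C := Fin q) (by simpa using hp)
  have hη1 : η < 1 := by linarith
  have hq1 : (1 : ℝ) ≤ q := by exact_mod_cast hq
  -- there are no unknown positions here, so the second component of a configuration is trivial
  let Ω : (((Fin q × Fin q) × Fin M → Bool) × ((Fin q × Fin q) × Fin M → Unit)) → MatTuple M p :=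
    fun θ m => a • (1 + blockMat e (bitBlock m₀ u θ.1 m))
  have habs : ∀ (γ : (Fin q × Fin q) × Fin M → Bool) m i j, |bitBlock m₀ u γ m i j| ≤ 3 * u m₀ := by
    intro γ m i j
    have h1 := hu0 m
    have h2 := hm₀ m
    unfold bitBlock
    rw [abs_of_nonneg (by positivity)]
    have h3 : (if m = m₀ then (2 : ℝ) else 0) + (if γ ((i, j), m) then 1 else 0) ≤ 3 := by
      split_ifs <;> norm_num
    nlinarith
  have hsmall : ∀ γ m, IsSmallSymm η (blockMat e (bitBlock m₀ u γ m)) := by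
    intro γ m
    have hη0 : 0 ≤ η := le_trans (by have := hu0 m₀; positivity) hu
    refine isSmallSymm_blockMat e hη0 (fun i => ?_) (fun j => ?_)
    · refine (Finset.sum_le_sum fun j _ => habs γ m i j).trans ?_
      simpa using hu
    · refine (Finset.sum_le_sum fun i _ => habs γ m i j).trans ?_
      simpa using hu
  have hΩrc : ∀ θ m i c, Ω θ m (rowIdx e i) (colIdx e c) = a * bitBlock m₀ u θ.1 m i c := by
    intro θ m i c
    simp [Ω, blockMat_row_col, rowIdx_ne_colIdx]
  refine le_minimaxRisk_of_forall l n μ hloss (R := Fin q) (C := Fin q) (q := q)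
    (by simp) (by simp) hq (rowIdx_injective e) (colIdx_injective e)
    (Finset.univ ×ˢ Finset.univ) (Finset.univ_nonempty.product Finset.univ_nonempty) Ω
    (fun θ _ => ?_) _ fun est hest => ?_
  · refine ⟨?_, regularCov_of_isSmallSymm (hsmall θ.1) hη1 ha hmin hmax⟩
    refine mem_Theta_of_hetero (by omega) (hsmall θ.1) hη1 ha (exists_ne_blockMat e ?_)
      (ncard_support_blockMat_le e (d := q) (fun i => ?_) (fun j => ?_)) hs₁ le_rfl
    · intro i j _
      have : Nontrivial (Fin M) := Fin.nontrivial_iff_two_le.2 hM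
      obtain ⟨m', hm'⟩ := exists_ne m₀
      refine ⟨m₀, m', ?_⟩
      have h1 := hm₀ m'
      have h2 := hu0 m'
      have h3 : 2 * u m₀ ≤ bitBlock m₀ u θ.1 m₀ i j := by
        have := hu0 m₀
        unfold bitBlock
        rw [if_pos rfl]
        split_ifs <;> linarith
      have h4 : bitBlock m₀ u θ.1 m' i j ≤ u m' := by
        unfold bitBlock
        rw [if_neg hm']
        split_ifs <;> simp
        exact h2.le
      intro h
      linarith
    · refine (Set.ncard_le_ncard (Set.subset_univ _) (Set.toFinite _)).trans (le_of_eq ?_)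
      rw [Set.ncard_univ, Nat.card_eq_fintype_card, Fintype.card_fin]
    · refine (Set.ncard_le_ncard (Set.subset_univ _) (Set.toFinite _)).trans (le_of_eq ?_)
      rw [Set.ncard_univ, Nat.card_eq_fintype_card, Fintype.card_fin]
  · set T : Finset (((Fin q × Fin q) × Fin M → Bool) × ((Fin q × Fin q) × Fin M → Unit)) :=
      Finset.univ ×ˢ Finset.univ with hT
    let base : Fin M → ℝ := fun m => if m = m₀ then 2 else 0
    -- the test of a bit compares the estimated entry with the midpoint of its two possible values
    let B : (Fin q × Fin q) × Fin M → Set (Data p n) := fun ξ =>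
      {x | a * (u ξ.2 * (base ξ.2 + 1 / 2)) < est x ξ.2 (rowIdx e ξ.1.1) (colIdx e ξ.1.2)}
    have hBm : ∀ ξ, MeasurableSet (B ξ) := fun ξ => measurableSet_lt measurable_const (hest _ _ _)
    let S : (((Fin q × Fin q) × Fin M → Bool) × ((Fin q × Fin q) × Fin M → Unit)) →
      (Fin q × Fin q) × Fin M → Set (Data p n) := fun θ ξ => if θ.1 ξ then (B ξ)ᶜ else B ξ
    have hSm : ∀ θ ξ, MeasurableSet (S θ ξ) := by
      intro θ ξ
      simp only [S]
      split_ifs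
      · exact (hBm ξ).compl
      · exact hBm ξ
    have hassouad : ∀ ξ, (T.card : ℝ≥0∞) / 4 ≤ ∑ θ ∈ T, dataLaw n μ (Ω θ) (S θ ξ) := by
      rintro ⟨⟨i, j⟩, m⟩
      refine card_div_four_le_sum_errors Finset.univ (fun γ f => dataLaw n μ (Ω (γ, f)))
        ((i, j), m) (B ((i, j), m)) fun γ f _ => ?_
      have hsum : ∑ m', (n m' : ℝ) * (if m' = m then u m else 0) ^ 2 = n m * u m ^ 2 := by
        rw [Finset.sum_eq_single m (fun m' _ h => by simp [h]) (by simp)]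
        simp
      have htest := needle_testing n μ ha hη
        (E := fun m' => blockMat e (bitBlock m₀ u (Function.update γ ((i, j), m) false) m'))
        (hsmall _) (u := fun m' => if m' = m then u m else 0) (i := rowIdx e i)
        (A := {colIdx e j}) (fun m' => ?_) ?_ ?_ ?_ (hBm ((i, j), m))
      · rw [Finset.card_singleton, Finset.sum_singleton] at htest
        have hfilter : (Finset.univ.filter fun v : Unit =>
            Function.update f ((i, j), m) v ∈ Finset.univ) = {()} := by ext; simp
        rw [hfilter, Finset.card_singleton, Finset.sum_singleton]
        refine htest.trans (le_of_eq ?_)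
        simp only [Ω, bitBlock_update, add_assoc]
      · refine le_trans ?_ hu
        have h1 := hu0 m
        have h2 := hm₀ m
        have h3 : |if m' = m then u m else 0| ≤ u m₀ := by
          split_ifs
          · rwa [abs_of_pos h1]
          · simp; linarith
        nlinarith [hu0 m₀]
      · simpa using rowIdx_ne_colIdx e i j
      · intro m' x hx y hy hxy
        rw [Finset.mem_singleton] at hx hy
        exact absurd (hx.trans hy.symm) hxy
      · rw [hsum]
        simpa using hτ m
    -- the weight of one site in the weighted norm, times half the size of its perturbation
    let w : Fin M → ℝ := fun m => 1 / (totalSize n : ℝ) * (n m * (a * u m)) / 2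
    have hw0 : ∀ m, 0 ≤ w m := fun m => by have := hu0 m; positivity
    have hwsum : ∑ m, w m = wnorm₁ n (fun m => a * u m) / 2 := by
      simp only [w, wnorm₁, ← Finset.sum_div, ← Finset.mul_sum]
      congr 2
      exact Finset.sum_congr rfl fun m _ => by
        rw [abs_of_pos (mul_pos ha (hu0 m))]
    have hpt : ∀ θ i j, ∑ m, ENNReal.ofReal (w m) * dataLaw n μ (Ω θ) (S θ ((i, j), m)) ≤
        ∫⁻ x, ENNReal.ofReal (wnorm₁ n (fun m => est x m (rowIdx e i) (colIdx e j) -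
          Ω θ m (rowIdx e i) (colIdx e j))) ∂(dataLaw n μ (Ω θ)) := by
      intro θ i j
      have h1 : ∑ m, ENNReal.ofReal (w m) * dataLaw n μ (Ω θ) (S θ ((i, j), m)) =
          ∫⁻ x, ∑ m, (S θ ((i, j), m)).indicator (fun _ => ENNReal.ofReal (w m)) x
            ∂(dataLaw n μ (Ω θ)) := by
        rw [lintegral_finsetSum _ fun m _ => measurable_const.indicator (hSm θ _)]
        exact Finset.sum_congr rfl fun m _ => (lintegral_indicator_const (hSm θ _) _).symm
      rw [h1]
      refine lintegral_mono fun x => ?_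
      have h2 : wnorm₁ n (fun m => est x m (rowIdx e i) (colIdx e j) -
          Ω θ m (rowIdx e i) (colIdx e j)) = ∑ m, 1 / (totalSize n : ℝ) * (n m *
          |est x m (rowIdx e i) (colIdx e j) - Ω θ m (rowIdx e i) (colIdx e j)|) := by
        rw [wnorm₁, Finset.mul_sum]
      rw [h2, ENNReal.ofReal_sum_of_nonneg fun m _ => by positivity]
      refine Finset.sum_le_sum fun m _ => ?_
      by_cases hx : x ∈ S θ ((i, j), m)
      · rw [Set.indicator_of_mem hx]
        refine ENNReal.ofReal_le_ofReal ?_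
        have h3 : a * u m / 2 ≤
            |est x m (rowIdx e i) (colIdx e j) - Ω θ m (rowIdx e i) (colIdx e j)| := by
          rw [hΩrc]
          by_cases hγ : θ.1 ((i, j), m) = true
          · have h4 : ¬ a * (u m * (base m + 1 / 2)) < est x m (rowIdx e i) (colIdx e j) := by
              simpa [S, hγ, B] using hx
            have h5 : a * bitBlock m₀ u θ.1 m i j = a * (u m * (base m + 1)) := by
              simp [bitBlock, hγ, base]
            rw [h5, abs_sub_comm]
            refine le_trans ?_ (le_abs_self _)
            linarith
          · have h4 : a * (u m * (base m + 1 / 2)) < est x m (rowIdx e i) (colIdx e j) := by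
              simpa [S, hγ, B] using hx
            have h5 : a * bitBlock m₀ u θ.1 m i j = a * (u m * base m) := by
              simp [bitBlock, hγ, base]
            rw [h5]
            refine le_trans ?_ (le_abs_self _)
            linarith
        calc w m = 1 / (totalSize n : ℝ) * (n m * (a * u m / 2)) := by simp only [w]; ring
          _ ≤ _ := by gcongr
      · rw [Set.indicator_of_notMem hx]
        exact zero_le
    set c := wnorm₁ n (fun m => a * u m) / 8 with hc
    have hc0 : 0 < c := by positivity
    have hlin : ∀ i j, (T.card : ℝ≥0∞) * ENNReal.ofReal c ≤
        ∑ θ ∈ T, ∫⁻ x, ENNReal.ofReal (wnorm₁ n (fun m => est x m (rowIdx e i) (colIdx e j) -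
          Ω θ m (rowIdx e i) (colIdx e j))) ∂(dataLaw n μ (Ω θ)) := by
      intro i j
      calc (T.card : ℝ≥0∞) * ENNReal.ofReal c
          = ∑ m, ENNReal.ofReal (w m) * ((T.card : ℝ≥0∞) / 4) := by
            rw [← Finset.sum_mul, ← ENNReal.ofReal_sum_of_nonneg fun m _ => hw0 m, hwsum,
              show c = wnorm₁ n (fun m => a * u m) / 2 / 4 by rw [hc]; ring,
              ENNReal.ofReal_div_of_pos (by norm_num), ENNReal.ofReal_ofNat]
            simp only [div_eq_mul_inv]
            ring
        _ ≤ ∑ m, ∑ θ ∈ T, ENNReal.ofReal (w m) * dataLaw n μ (Ω θ) (S θ ((i, j), m)) := by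
            refine Finset.sum_le_sum fun m _ => ?_
            rw [← Finset.mul_sum]
            exact mul_le_mul_right (hassouad _) _
        _ ≤ _ := by
            rw [Finset.sum_comm]
            exact Finset.sum_le_sum fun θ _ => hpt θ i j
    -- a lower bound for the mean of a nonnegative variable gives one for its `r`-th moment
    have hyoung : ∀ y : ℝ, 0 ≤ y → y ≤ c / 2 + ((c / 2) ^ (r - 1))⁻¹ * y ^ r := by
      intro y hy
      have hcr : 0 < (c / 2) ^ (r - 1) := Real.rpow_pos_of_pos (by positivity) _
      rcases le_total y (c / 2) with h | h
      · have : 0 ≤ ((c / 2) ^ (r - 1))⁻¹ * y ^ r := by positivity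
        linarith
      · have hy0 : 0 < y := lt_of_lt_of_le (by positivity) h
        have h1 : y ^ r = y ^ (r - 1) * y := by
          rw [← Real.rpow_add_one hy0.ne', sub_add_cancel]
        have h2 : (c / 2) ^ (r - 1) ≤ y ^ (r - 1) :=
          Real.rpow_le_rpow (by positivity) h (by linarith)
        have h3 : 1 ≤ ((c / 2) ^ (r - 1))⁻¹ * y ^ (r - 1) := by
          rw [← div_eq_inv_mul, le_div_iff₀ hcr]; linarith
        rw [h1, ← mul_assoc]
        nlinarith
    have hpow : ∀ i j, (T.card : ℝ≥0∞) * ENNReal.ofReal ((c / 2) ^ r) ≤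
        ∑ θ ∈ T, ∫⁻ x, ENNReal.ofReal (wnorm₁ n (fun m => est x m (rowIdx e i) (colIdx e j) -
          Ω θ m (rowIdx e i) (colIdx e j)) ^ r) ∂(dataLaw n μ (Ω θ)) := by
      intro i j
      set Z := ∑ θ ∈ T, ∫⁻ x, ENNReal.ofReal (wnorm₁ n (fun m => est x m (rowIdx e i) (colIdx e j) -
          Ω θ m (rowIdx e i) (colIdx e j)) ^ r) ∂(dataLaw n μ (Ω θ)) with hZ
      have hcr : 0 < (c / 2) ^ (r - 1) := Real.rpow_pos_of_pos (by positivity) _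
      have h1 : (T.card : ℝ≥0∞) * ENNReal.ofReal c ≤ T.card * ENNReal.ofReal (c / 2) +
          ENNReal.ofReal ((c / 2) ^ (r - 1))⁻¹ * Z := by
        refine (hlin i j).trans ?_
        rw [hZ, Finset.mul_sum, ← nsmul_eq_mul, ← Finset.sum_const, ← Finset.sum_add_distrib]
        refine Finset.sum_le_sum fun θ _ => ?_
        rw [← lintegral_const_mul' _ _ ENNReal.ofReal_ne_top]
        have h2 : ENNReal.ofReal (c / 2) = ∫⁻ _, ENNReal.ofReal (c / 2) ∂(dataLaw n μ (Ω θ)) := by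
          simp
        conv_rhs => rw [h2]
        rw [← lintegral_add_left measurable_const]
        refine lintegral_mono fun x => ?_
        rw [← ENNReal.ofReal_mul (by positivity), ← ENNReal.ofReal_add (by positivity)
          (mul_nonneg (by positivity) (Real.rpow_nonneg (wnorm₁_nonneg _ _) _))]
        exact ENNReal.ofReal_le_ofReal (hyoung _ (wnorm₁_nonneg _ _))
      have h3 : (T.card : ℝ≥0∞) * ENNReal.ofReal (c / 2) ≤
          ENNReal.ofReal ((c / 2) ^ (r - 1))⁻¹ * Z := by
        have h4 : ENNReal.ofReal c = ENNReal.ofReal (c / 2) + ENNReal.ofReal (c / 2) := by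
          rw [← ENNReal.ofReal_add (by positivity) (by positivity), add_halves]
        rw [h4, mul_add] at h1
        exact (ENNReal.add_le_add_iff_left
          (ENNReal.mul_ne_top (ENNReal.natCast_ne_top _) ENNReal.ofReal_ne_top)).1 h1
      have h5 := mul_le_mul_right h3 (ENNReal.ofReal ((c / 2) ^ (r - 1)))
      rw [← mul_assoc _ _ Z, ← ENNReal.ofReal_mul hcr.le, mul_inv_cancel₀ hcr.ne',
        ENNReal.ofReal_one, one_mul, mul_left_comm, ← ENNReal.ofReal_mul hcr.le,
        ← Real.rpow_add_one (by positivity), sub_add_cancel] at h5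
      exact h5
    calc (T.card : ℝ≥0∞) * (q * ENNReal.ofReal (q * (wnorm₁ n (fun m => a * u m) / 16) ^ r))
        = ∑ _i : Fin q, ∑ _j : Fin q, (T.card : ℝ≥0∞) * ENNReal.ofReal ((c / 2) ^ r) := by
          rw [show c / 2 = wnorm₁ n (fun m => a * u m) / 16 by rw [hc]; ring]
          simp only [Finset.sum_const, Finset.card_univ, Fintype.card_fin, nsmul_eq_mul]
          rw [ENNReal.ofReal_mul (Nat.cast_nonneg _), ENNReal.ofReal_natCast]
          ring
      _ ≤ _ := by
          refine (Finset.sum_le_sum fun i _ => Finset.sum_le_sum fun j _ => hpow i j).trans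
            (le_of_eq ?_)
          symm
          rw [Finset.sum_comm]
          exact Finset.sum_congr rfl fun i _ => Finset.sum_comm

/-! ### Rates -/

lemma exp_le_five_quarters {x : ℝ} (hx : x ≤ 1 / 5) : Real.exp x ≤ 5 / 4 := by
  have h1 := Real.add_one_le_exp (-x)
  rw [Real.exp_neg] at h1
  have h2 := Real.exp_pos x
  have h3 : 4 / 5 ≤ (Real.exp x)⁻¹ := by linarith
  rw [le_inv_comm₀ (by norm_num) h2] at h3
  linarith

lemma four_mul_exp_le_sqrt {p : ℕ} (hp : 1024 ≤ p) {x : ℝ} (hx : x ≤ Real.log p / 4) :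
    4 * Real.exp x ≤ Nat.sqrt p := by
  have hp0 : (0 : ℝ) < p := by exact_mod_cast (by omega : 0 < p)
  have h1 : Real.exp x ^ 4 ≤ p := by
    rw [← Real.exp_nat_mul]
    calc Real.exp (((4 : ℕ) : ℝ) * x) ≤ Real.exp (Real.log p) :=
          Real.exp_le_exp.2 (by push_cast; linarith)
      _ = p := Real.exp_log hp0
  have h2 : 32 ≤ Nat.sqrt p := Nat.le_sqrt.2 (by omega)
  have h3 : p ≤ 4 * (Nat.sqrt p * Nat.sqrt p) := by
    have := Nat.lt_succ_sqrt p
    simp only [Nat.succ_eq_add_one] at this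
    nlinarith
  have h3' : (p : ℝ) ≤ 4 * ((Nat.sqrt p : ℝ) * Nat.sqrt p) := by exact_mod_cast h3
  have h2' : (32 : ℝ) ≤ Nat.sqrt p := by exact_mod_cast h2
  set y : ℝ := (Nat.sqrt p : ℝ)
  have h4 : Real.exp x ^ 2 ≤ 2 * y := by
    refine le_of_sq_le_sq ?_ (by linarith)
    nlinarith
  refine le_of_sq_le_sq ?_ (by linarith)
  nlinarith

lemma sum_cast_eq_totalSize {M : ℕ} (n : Fin M → ℕ) : ∑ m, (n m : ℝ) = totalSize n := by
  simp [totalSize]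

/-- The lower bound at the rate `ψ₁`, for needles of strength of order `ψ₁` whose profile over the
sites is `v`. -/
lemma needle_rate (l : ℝ≥0∞) [Fact (1 ≤ l)] {M p : ℕ} (hM : 0 < M) (n : Fin M → ℕ)
    (μ : Fin M → EuclideanSpace ℝ (Fin p)) {Cmin Cmax : ℝ} (hCmin : 0 < Cmin) {s₁ s₂ : ℕ} {r : ℝ}
    (hr : 0 ≤ r) {loss : MatTuple M p → MatTuple M p → Matrix (Fin p) (Fin p) ℝ}
    (hloss : ∀ A B j k, wnorm₁ n (fun m => A m j k - B m j k) ^ r ≤ loss A B j k)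
    {a : ℝ} (ha : 0 < a) {η : ℝ} (hη0 : 0 < η) (hη : η ≤ 1 / 8)
    (hmin : Cmin * (a * (1 + η)) ≤ 1) (hmax : 1 ≤ Cmax * (a * (1 - η)))
    (hp : 1024 ≤ p) (hN : 0 < totalSize n) {K : ℕ} (hK : 2 ≤ K) (hKp : K * K ≤ p)
    (hKN : (K : ℝ) ^ 2 * Real.log p ^ 3 ≤ η ^ 2 * totalSize n)
    {v : Fin M → ℝ} (hv1 : ∀ m, 1 / 2 ≤ v m) (hv2 : ∀ m, v m ≤ 1)
    (hΘ : (∀ m m', v m = v m') ∧ K + 1 ≤ s₁ ∨ (∃ m m', v m ≠ v m') ∧ K ≤ s₂ ∧ 1 ≤ s₁) :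
    ENNReal.ofReal ((a / 40) ^ r / 16 * (K * psi₁ p (totalSize n) ^ r)) ≤
      minimaxRisk l n μ Cmin Cmax s₁ s₂ loss := by
  have hN' : (0 : ℝ) < totalSize n := by exact_mod_cast hN
  set N : ℝ := (totalSize n : ℝ) with hNdef
  set ψ := psi₁ p (totalSize n) with hψ
  have hlog : 1 ≤ Real.log p := by
    rw [Real.le_log_iff_exp_le (by exact_mod_cast (by omega : 0 < p))]
    have h3 : (3 : ℝ) ≤ p := by exact_mod_cast (by omega : 3 ≤ p)
    have := Real.exp_one_lt_d9
    linarith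
  have hψ2 : ψ ^ 2 = Real.log p / N := Real.sq_sqrt (by positivity)
  have hψ0 : 0 < ψ := Real.sqrt_pos.2 (by positivity)
  have hK0 : (0 : ℝ) < K := by exact_mod_cast (by omega : 0 < K)
  have hlog3 : Real.log p ≤ Real.log p ^ 3 := by
    calc Real.log p = Real.log p ^ 1 := (pow_one _).symm
      _ ≤ _ := pow_le_pow_right₀ hlog (by norm_num)
  have hlog2 : Real.log p ^ 2 ≤ Real.log p ^ 3 := pow_le_pow_right₀ hlog (by norm_num)
  -- the needles have strength `ψ * v m / 10`, and `η'` bounds their absolute row sums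
  have hKψ : (K * ψ) ^ 2 ≤ η ^ 2 := by
    rw [mul_pow, hψ2, ← mul_div_assoc, div_le_iff₀ hN']
    exact (mul_le_mul_of_nonneg_left hlog3 (by positivity)).trans hKN
  have hKψ' : K * ψ ≤ η := le_of_sq_le_sq hKψ hη0.le
  set η' := K * (ψ / 10) with hη'
  have hη'0 : 0 < η' := by positivity
  have hη'η : η' ≤ η := by rw [hη']; nlinarith
  have hτ : ∑ m, n m * (ψ / 10 * v m) ^ 2 ≤ Real.log p / 100 := by
    calc ∑ m, n m * (ψ / 10 * v m) ^ 2 ≤ ∑ m, (n m : ℝ) * (ψ / 10) ^ 2 := by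
          refine Finset.sum_le_sum fun m _ => mul_le_mul_of_nonneg_left ?_ (by positivity)
          have := hv1 m
          refine pow_le_pow_left₀ (by positivity) ?_ 2
          exact mul_le_of_le_one_right (by positivity) (hv2 m)
      _ = N * (ψ / 10) ^ 2 := by rw [← Finset.sum_mul, sum_cast_eq_totalSize]
      _ = Real.log p / 100 := by rw [div_pow, hψ2]; field_simp; norm_num
  have hητ : η' ^ 2 * ∑ m, n m * (ψ / 10 * v m) ^ 2 ≤ 1 / 10000 := by
    calc η' ^ 2 * ∑ m, n m * (ψ / 10 * v m) ^ 2 ≤ η' ^ 2 * (Real.log p / 100) := by gcongr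
      _ = (K ^ 2 * Real.log p ^ 2 / N) / 10000 := by
          rw [hη', mul_pow, div_pow, hψ2]; field_simp; norm_num
      _ ≤ 1 / 10000 := by
          gcongr
          rw [div_le_one hN']
          calc (K : ℝ) ^ 2 * Real.log p ^ 2 ≤ K ^ 2 * Real.log p ^ 3 := by gcongr
            _ ≤ η ^ 2 * N := hKN
            _ ≤ 1 * N := by gcongr; nlinarith
            _ = N := one_mul _
  have hKb : K ≤ Nat.sqrt p := Nat.le_sqrt.2 hKp
  have hb : 0 < Nat.sqrt p := by omega
  have hbk : Nat.sqrt p * (K / 2) + K / 2 * Nat.sqrt p ≤ p := by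
    have h1 : 2 * (K / 2) ≤ K := Nat.mul_div_le K 2
    have h2 := Nat.sqrt_le p
    calc _ = Nat.sqrt p * (2 * (K / 2)) := by ring
      _ ≤ Nat.sqrt p * Nat.sqrt p := Nat.mul_le_mul_left _ (h1.trans hKb)
      _ ≤ p := h2
  have hCa : Cmin * (a * (1 + η')) ≤ 1 := le_trans (by gcongr) hmin
  have hCmax : 0 < Cmax := by
    by_contra h
    have : Cmax * (a * (1 - η)) ≤ 0 :=
      mul_nonpos_of_nonpos_of_nonneg (not_lt.1 h) (mul_nonneg ha.le (by linarith))
    linarith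
  have hCb : 1 ≤ Cmax * (a * (1 - η')) := hmax.trans (by gcongr)
  have hmain := needle_lower_bound l hM n μ hr hloss (b := Nat.sqrt p) (k := K / 2) (K := K) hb
    (by omega) (Nat.mul_div_le K 2) hbk ha (hη'η.trans hη) hCa hCb
    (u := fun m => ψ / 10 * v m) (fun m => ?_) ?_ ?_ ?_ (s₁ := s₁) (s₂ := s₂)
  · refine le_trans (ENNReal.ofReal_le_ofReal ?_) hmain
    have hω : a * (ψ / 10) / 2 ≤ wnorm₁ n fun m => a * (ψ / 10 * v m) := by
      unfold wnorm₁
      calc a * (ψ / 10) / 2 = 1 / N * ∑ m, (n m : ℝ) * (a * (ψ / 10) / 2) := by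
            rw [← Finset.sum_mul, sum_cast_eq_totalSize]; field_simp; rfl
        _ ≤ _ := by
            refine mul_le_mul_of_nonneg_left (Finset.sum_le_sum fun m _ => ?_) (by positivity)
            refine mul_le_mul_of_nonneg_left ?_ (by positivity)
            refine le_trans ?_ (le_abs_self _)
            have := hv1 m
            calc a * (ψ / 10) / 2 = a * (ψ / 10 * (1 / 2)) := by ring
              _ ≤ a * (ψ / 10 * v m) := by gcongr
    have hk4 : (K : ℝ) / 4 ≤ (K / 2 : ℕ) := by
      have : K ≤ 4 * (K / 2) := by omega
      have : (K : ℝ) ≤ 4 * (K / 2 : ℕ) := by exact_mod_cast this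
      linarith
    calc (a / 40) ^ r / 16 * (K * ψ ^ r) = K / 4 * (a * (ψ / 10) / 2 / 2) ^ r / 4 := by
          rw [show a * (ψ / 10) / 2 / 2 = a / 40 * ψ by ring,
            Real.mul_rpow (by positivity) hψ0.le]
          ring
      _ ≤ _ := by gcongr
  · have := hv1 m
    rw [abs_of_nonneg (by positivity)]
    refine mul_le_mul_of_nonneg_left ?_ hK0.le
    exact mul_le_of_le_one_right (by positivity) (hv2 m)
  · refine hΘ.imp (fun h => ⟨fun m m' => by rw [h.1 m m'], h.2⟩) fun ⟨⟨m, m', hmm⟩, h⟩ =>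
      ⟨⟨m, m', fun he => hmm ?_⟩, h⟩
    exact mul_left_cancel₀ (by positivity) he
  · exact (exp_le_five_quarters (by linarith)).trans (by norm_num)
  · exact four_mul_exp_le_sqrt hp (by linarith)

lemma minSize_le {M : ℕ} (n : Fin M → ℕ) (m : Fin M) : minSize n ≤ n m :=
  ciInf_le (OrderBot.bddBelow _) m

/-- The lower bound at the rate `√(M / N)`, for perturbations of size of order `1 / √(n m)` at
site `m`. -/
lemma bit_rate (l : ℝ≥0∞) [Fact (1 ≤ l)] {M p : ℕ} (hM : 2 ≤ M) (n : Fin M → ℕ)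
    (μ : Fin M → EuclideanSpace ℝ (Fin p)) {Cmin Cmax : ℝ} {s₁ q : ℕ} {r : ℝ} (hr : 1 ≤ r)
    {loss : MatTuple M p → MatTuple M p → Matrix (Fin p) (Fin p) ℝ}
    (hloss : ∀ A B j k, wnorm₁ n (fun m => A m j k - B m j k) ^ r ≤ loss A B j k)
    {a : ℝ} (ha : 0 < a) {η : ℝ} (hη0 : 0 < η) (hη : η ≤ 1 / 8)
    (hmin : Cmin * (a * (1 + η)) ≤ 1) (hmax : 1 ≤ Cmax * (a * (1 - η)))
    (hn : 0 < minSize n) (hs₁ : 1 ≤ s₁) (hq : 0 < q) (hqp : q + q ≤ p) {C : ℝ} (hC : 0 < C)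
    (hNn : (totalSize n : ℝ) ≤ C * (minSize n * M))
    (hqN : C * ((q : ℝ) ^ 2 * M) ≤ η ^ 2 * totalSize n) :
    ENNReal.ofReal ((a / (160 * √C)) ^ r * (q * √((M : ℝ) / totalSize n) ^ r)) ≤
      minimaxRisk l n μ Cmin Cmax s₁ q loss := by
  have hM0 : 0 < M := by omega
  have hM' : (0 : ℝ) < M := by exact_mod_cast hM0
  have hn' : (0 : ℝ) < minSize n := by exact_mod_cast hn
  have hnm : ∀ m, (minSize n : ℝ) ≤ n m := fun m => by exact_mod_cast minSize_le n m
  have hnm0 : ∀ m, (0 : ℝ) < n m := fun m => hn'.trans_le (hnm m)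
  have hNlow : (M : ℝ) * minSize n ≤ totalSize n := by
    rw [← sum_cast_eq_totalSize]
    calc (M : ℝ) * minSize n = ∑ _m : Fin M, (minSize n : ℝ) := by simp
      _ ≤ _ := Finset.sum_le_sum fun m _ => hnm m
  have hN' : (0 : ℝ) < totalSize n := lt_of_lt_of_le (by positivity) hNlow
  set N : ℝ := (totalSize n : ℝ) with hNdef
  set ν : ℝ := (minSize n : ℝ) with hν
  have hu0 : ∀ m, 0 < 1 / (10 * √(n m : ℝ)) := fun m => by
    have := Real.sqrt_pos.2 (hnm0 m); positivity
  obtain ⟨m₀, -, hm₀⟩ := Finset.exists_min_image (Finset.univ : Finset (Fin M)) n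
    ⟨⟨0, hM0⟩, Finset.mem_univ _⟩
  have humax : ∀ m, 1 / (10 * √(n m : ℝ)) ≤ 1 / (10 * √(n m₀ : ℝ)) := fun m => by
    have := Real.sqrt_pos.2 (hnm0 m₀)
    have h2 : (n m₀ : ℝ) ≤ n m := by exact_mod_cast hm₀ m (Finset.mem_univ _)
    gcongr
  have hqν : (q : ℝ) ^ 2 ≤ η ^ 2 * ν := by
    have h1 : C * M * (q : ℝ) ^ 2 ≤ C * M * (η ^ 2 * ν) := by
      calc C * M * (q : ℝ) ^ 2 = C * (q ^ 2 * M) := by ring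
        _ ≤ η ^ 2 * N := hqN
        _ ≤ η ^ 2 * (C * (ν * M)) := by gcongr
        _ = _ := by ring
    exact le_of_mul_le_mul_left h1 (by positivity)
  have hω : a / (10 * √C) * √((M : ℝ) / N) ≤ wnorm₁ n fun m => a * (1 / (10 * √(n m : ℝ))) := by
    have h1 : ∀ m, a / 10 * √ν ≤ (n m : ℝ) * |a * (1 / (10 * √(n m : ℝ)))| := by
      intro m
      rw [abs_of_pos (mul_pos ha (hu0 m))]
      have hs := Real.sqrt_pos.2 (hnm0 m)
      calc a / 10 * √ν ≤ a / 10 * √(n m : ℝ) := by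
            gcongr; exact hnm m
        _ = (√(n m : ℝ) * √(n m : ℝ)) * (a * (1 / (10 * √(n m : ℝ)))) := by field_simp
        _ = _ := by rw [Real.mul_self_sqrt (hnm0 m).le]
    have h2 : 1 / N * (M * (a / 10 * √ν)) ≤ wnorm₁ n fun m => a * (1 / (10 * √(n m : ℝ))) := by
      unfold wnorm₁
      refine mul_le_mul_of_nonneg_left ?_ (by positivity)
      calc (M : ℝ) * (a / 10 * √ν) = ∑ _m : Fin M, a / 10 * √ν := by simp
        _ ≤ _ := Finset.sum_le_sum fun m _ => h1 m
    refine le_trans ?_ h2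
    have h3 : √((M : ℝ) / N) / √C ≤ 1 / N * (M * √ν) := by
      rw [← Real.sqrt_div (by positivity)]
      refine Real.sqrt_le_left (by positivity) |>.2 ?_
      rw [mul_pow, mul_pow, Real.sq_sqrt hn'.le, div_div, div_le_iff₀ (by positivity)]
      calc (M : ℝ) = M * (N / N) := by rw [div_self hN'.ne', mul_one]
        _ ≤ M * (C * (ν * M) / N) := by gcongr
        _ = _ := by field_simp
    calc a / (10 * √C) * √((M : ℝ) / N) = a / 10 * (√((M : ℝ) / N) / √C) := by
          have := Real.sqrt_pos.2 hC; field_simp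
      _ ≤ a / 10 * (1 / N * (M * √ν)) := by gcongr
      _ = _ := by ring
  have hω0 : 0 < a / (10 * √C) * √((M : ℝ) / N) := by
    have := Real.sqrt_pos.2 hC
    have : 0 < √((M : ℝ) / N) := Real.sqrt_pos.2 (by positivity)
    positivity
  refine le_trans (ENNReal.ofReal_le_ofReal ?_) (bit_lower_bound l hM n μ hr hloss hq hqp hs₁ ha hη
    hmin hmax hu0 humax ?_ (fun m => ?_) (hω0.trans_le hω))
  · calc (a / (160 * √C)) ^ r * (q * √((M : ℝ) / N) ^ r)
        = q * (a / (10 * √C) * √((M : ℝ) / N) / 16) ^ r := by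
          rw [show a / (10 * √C) * √((M : ℝ) / N) / 16 = a / (160 * √C) * √((M : ℝ) / N) by
            have := Real.sqrt_pos.2 hC; field_simp; norm_num,
            Real.mul_rpow (by positivity) (Real.sqrt_nonneg _)]
          ring
      _ ≤ _ := by gcongr
  · have hs := Real.sqrt_pos.2 (hnm0 m₀)
    have h1 : (q : ℝ) ≤ η * √(n m₀ : ℝ) := by
      refine le_of_sq_le_sq ?_ (by positivity)
      rw [mul_pow, Real.sq_sqrt (hnm0 m₀).le]
      exact hqν.trans (by gcongr; exact hnm m₀)
    rw [mul_one_div, mul_div_assoc', div_le_iff₀ (by positivity)]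
    nlinarith
  · have hs := Real.sqrt_pos.2 (hnm0 m)
    have : 20 * ((n m : ℝ) * (1 / (10 * √(n m : ℝ))) ^ 2) = 1 / 5 := by
      rw [div_pow, mul_pow, Real.sq_sqrt (hnm0 m).le]
      have := hnm0 m
      field_simp
      norm_num
    rw [this]
    exact (exp_le_five_quarters le_rfl).trans (by norm_num)

/-- The two parts of `ψ₂` are treated separately. -/
lemma psi₂_rpow_le {M p N : ℕ} {r : ℝ} (hr : 0 ≤ r) :
    psi₂ M p N ^ r ≤ 2 ^ r * (√((M : ℝ) / N) ^ r + psi₁ p N ^ r) := by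
  have h1 : psi₂ M p N ≤ √((M : ℝ) / N) + psi₁ p N := by
    unfold psi₂ psi₁
    rw [add_div]
    have h2 := Real.sqrt_nonneg ((M : ℝ) / N)
    have h3 := Real.sqrt_nonneg (Real.log p / N)
    have h4 := Real.sq_sqrt (show 0 ≤ (M : ℝ) / N by positivity)
    have h5 := Real.sq_sqrt (div_nonneg (Real.log_natCast_nonneg p) (Nat.cast_nonneg (α := ℝ) N))
    rw [Real.sqrt_le_left (by positivity)]
    nlinarith [mul_nonneg h2 h3]
  set x := √((M : ℝ) / N)
  set y := psi₁ p N
  have hx : 0 ≤ x := Real.sqrt_nonneg _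
  have hy : 0 ≤ y := Real.sqrt_nonneg _
  have hz : 0 ≤ psi₂ M p N := Real.sqrt_nonneg _
  have hxr := Real.rpow_nonneg hx r
  have hyr := Real.rpow_nonneg hy r
  have h2r : 0 < (2 : ℝ) ^ r := Real.rpow_pos_of_pos two_pos r
  rcases le_total x y with h | h
  · calc psi₂ M p N ^ r ≤ (2 * y) ^ r := Real.rpow_le_rpow hz (by linarith) hr
      _ = 2 ^ r * y ^ r := Real.mul_rpow two_pos.le hy
      _ ≤ _ := by gcongr; linarith
  · calc psi₂ M p N ^ r ≤ (2 * x) ^ r := Real.rpow_le_rpow hz (by linarith) hr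
      _ = 2 ^ r * x ^ r := Real.mul_rpow two_pos.le hx
      _ ≤ _ := by gcongr; linarith

/-- The minimax lower bound at a fixed problem size. -/
lemma ofReal_rate_le_minimaxRisk (l : ℝ≥0∞) [Fact (1 ≤ l)] {M p : ℕ} (hM : 2 ≤ M) (n : Fin M → ℕ)
    (μ : Fin M → EuclideanSpace ℝ (Fin p)) {Cmin Cmax : ℝ} (hCmin : 0 < Cmin) {s₁ s₂ : ℕ} {r : ℝ}
    (hr : 1 ≤ r) {loss : MatTuple M p → MatTuple M p → Matrix (Fin p) (Fin p) ℝ}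
    (hloss : ∀ A B j k, wnorm₁ n (fun m => A m j k - B m j k) ^ r ≤ loss A B j k)
    {a : ℝ} (ha : 0 < a) {η : ℝ} (hη0 : 0 < η) (hη : η ≤ 1 / 8)
    (hmin : Cmin * (a * (1 + η)) ≤ 1) (hmax : 1 ≤ Cmax * (a * (1 - η)))
    (hp : 1024 ≤ p) (hn : 0 < minSize n) (hs₁ : 3 ≤ s₁) (hs₂ : 2 ≤ s₂) (hs₂p : s₂ + s₂ ≤ p)
    (hNp : totalSize n ≤ p)
    (hKN : (max s₁ s₂ : ℝ) ^ 2 * Real.log p ^ 3 ≤ η ^ 2 * totalSize n) {C : ℝ} (hC : 0 < C)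
    (hNn : (totalSize n : ℝ) ≤ C * (minSize n * M))
    (hqN : C * ((s₂ : ℝ) ^ 2 * M) ≤ η ^ 2 * totalSize n) {κ : ℝ} (hκ0 : 0 < κ)
    (hκ1 : κ ≤ (a / 40) ^ r / 32) (hκ2 : κ ≤ (a / (160 * √C)) ^ r) :
    ENNReal.ofReal (κ / (3 * 2 ^ r) * (s₁ * psi₁ p (totalSize n) ^ r +
      s₂ * psi₂ M p (totalSize n) ^ r)) ≤ minimaxRisk l n μ Cmin Cmax s₁ s₂ loss := by
  have hM0 : 0 < M := by omega
  have hlog : 1 ≤ Real.log p := by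
    rw [Real.le_log_iff_exp_le (by exact_mod_cast (by omega : 0 < p))]
    have h3 : (3 : ℝ) ≤ p := by exact_mod_cast (by omega : 3 ≤ p)
    have := Real.exp_one_lt_d9
    linarith
  have hN : 0 < totalSize n := by
    have h1 := minSize_le n ⟨0, hM0⟩
    have h2 : n ⟨0, hM0⟩ ≤ totalSize n :=
      Finset.single_le_sum (f := n) (fun _ _ => Nat.zero_le _) (Finset.mem_univ _)
    omega
  have hKcond : ∀ K : ℕ, (K : ℝ) ≤ max (s₁ : ℝ) (s₂ : ℝ) → K * K ≤ p ∧
      (K : ℝ) ^ 2 * Real.log p ^ 3 ≤ η ^ 2 * totalSize n := by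
    intro K hK
    have h1 : (K : ℝ) ^ 2 * Real.log p ^ 3 ≤ η ^ 2 * totalSize n :=
      le_trans (by gcongr) hKN
    refine ⟨?_, h1⟩
    have h2 : (K : ℝ) * K ≤ p := by
      calc (K : ℝ) * K = K ^ 2 * 1 := by ring
        _ ≤ K ^ 2 * Real.log p ^ 3 := by gcongr; exact one_le_pow₀ hlog
        _ ≤ η ^ 2 * totalSize n := h1
        _ ≤ 1 * p := by gcongr; nlinarith
        _ = p := one_mul _
    exact_mod_cast h2
  set R := minimaxRisk l n μ Cmin Cmax s₁ s₂ loss with hR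
  set ψ := psi₁ p (totalSize n) with hψ
  set φ := √((M : ℝ) / totalSize n) with hφ
  have hψr : 0 ≤ ψ ^ r := Real.rpow_nonneg (Real.sqrt_nonneg _) r
  have hφr : 0 ≤ φ ^ r := Real.rpow_nonneg (Real.sqrt_nonneg _) r
  have har : 0 < (a / 40) ^ r := Real.rpow_pos_of_pos (by positivity) r
  -- the diagonal entry is common to all sites, which leaves `s₁ - 1` entries per column for needles
  have hA : ENNReal.ofReal (κ * (s₁ * ψ ^ r)) ≤ R := by
    obtain ⟨h1, h2⟩ := hKcond (s₁ - 1) ((Nat.cast_le.2 (Nat.sub_le _ _)).trans (le_max_left _ _))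
    refine le_trans (ENNReal.ofReal_le_ofReal ?_) (needle_rate l hM0 n μ hCmin (by linarith) hloss
      ha hη0 hη hmin hmax hp hN (K := s₁ - 1) (by omega) h1 h2 (v := fun _ => 1)
      (fun _ => by norm_num) (fun _ => le_rfl) (Or.inl ⟨fun _ _ => rfl, by omega⟩))
    have h3 : (s₁ : ℝ) / 2 ≤ ((s₁ - 1 : ℕ) : ℝ) := by
      have : s₁ ≤ 2 * (s₁ - 1) := by omega
      have : (s₁ : ℝ) ≤ 2 * ((s₁ - 1 : ℕ) : ℝ) := by exact_mod_cast this
      linarith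
    calc κ * (s₁ * ψ ^ r) ≤ (a / 40) ^ r / 32 * (s₁ * ψ ^ r) := by gcongr
      _ = (a / 40) ^ r / 16 * (s₁ / 2 * ψ ^ r) := by ring
      _ ≤ _ := by gcongr
  -- needles of half strength at the first site are heterogeneous
  have hB : ENNReal.ofReal (κ * (s₂ * ψ ^ r)) ≤ R := by
    obtain ⟨h1, h2⟩ := hKcond s₂ (le_max_right _ _)
    refine le_trans (ENNReal.ofReal_le_ofReal ?_) (needle_rate l hM0 n μ hCmin (by linarith) hloss
      ha hη0 hη hmin hmax hp hN (K := s₂) hs₂ h1 h2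
      (v := fun m => if m = ⟨0, hM0⟩ then 1 / 2 else 1)
      (fun m => by split_ifs <;> norm_num)
      (fun m => by split_ifs <;> norm_num)
      (Or.inr ⟨⟨⟨0, hM0⟩, ⟨1, by omega⟩, by simp⟩, le_rfl, by omega⟩))
    have h4 : κ ≤ (a / 40) ^ r / 16 := hκ1.trans (by linarith)
    gcongr
  have hC' : ENNReal.ofReal (κ * (s₂ * φ ^ r)) ≤ R := by
    refine le_trans (ENNReal.ofReal_le_ofReal ?_) (bit_rate l hM n μ hr hloss ha hη0 hη hmin hmax hn
      (by omega) (by omega) hs₂p hC hNn hqN)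
    gcongr
  have h2r : 1 ≤ (2 : ℝ) ^ r := Real.one_le_rpow one_le_two (by linarith)
  have hsum : κ / (3 * 2 ^ r) * (s₁ * ψ ^ r + s₂ * psi₂ M p (totalSize n) ^ r) ≤
      (κ * (s₁ * ψ ^ r) + κ * (s₂ * ψ ^ r) + κ * (s₂ * φ ^ r)) / 3 := by
    have h5 := psi₂_rpow_le (M := M) (p := p) (N := totalSize n) (r := r) (by linarith)
    calc κ / (3 * 2 ^ r) * (s₁ * ψ ^ r + s₂ * psi₂ M p (totalSize n) ^ r)
        ≤ κ / (3 * 2 ^ r) * (2 ^ r * (s₁ * ψ ^ r) + s₂ * (2 ^ r * (φ ^ r + ψ ^ r))) := by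
          exact mul_le_mul_of_nonneg_left (add_le_add
            (le_mul_of_one_le_left (by positivity) h2r)
            (mul_le_mul_of_nonneg_left h5 (by positivity))) (by positivity)
      _ = _ := by field_simp; ring
  have hcases : κ / (3 * 2 ^ r) * (s₁ * ψ ^ r + s₂ * psi₂ M p (totalSize n) ^ r) ≤
      max (κ * (s₁ * ψ ^ r)) (max (κ * (s₂ * ψ ^ r)) (κ * (s₂ * φ ^ r))) := by
    have h6 := le_max_left (κ * (s₁ * ψ ^ r)) (max (κ * (s₂ * ψ ^ r)) (κ * (s₂ * φ ^ r)))
    have h7 := le_max_right (κ * (s₁ * ψ ^ r)) (max (κ * (s₂ * ψ ^ r)) (κ * (s₂ * φ ^ r)))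
    have h8 := le_max_left (κ * (s₂ * ψ ^ r)) (κ * (s₂ * φ ^ r))
    have h9 := le_max_right (κ * (s₂ * ψ ^ r)) (κ * (s₂ * φ ^ r))
    linarith
  refine (ENNReal.ofReal_le_ofReal hcases).trans ?_
  rcases max_choice (κ * (s₁ * ψ ^ r)) (max (κ * (s₂ * ψ ^ r)) (κ * (s₂ * φ ^ r))) with h | h <;>
    rw [h]
  · exact hA
  · rcases max_choice (κ * (s₂ * ψ ^ r)) (κ * (s₂ * φ ^ r)) with h' | h' <;> rw [h']
    · exact hB
    · exact hC'

end IntegrativePrecision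

theorem theorem3
    -- the sequence of problems, indexed by `t : ℕ`
    (p M s₁ s₂ : ℕ → ℕ) (n : (t : ℕ) → Fin (M t) → ℕ)
    (μ : (t : ℕ) → Fin (M t) → EuclideanSpace ℝ (Fin (p t)))
    (Cmin Cmax : ℝ) (hCmin : 0 < Cmin) (hC : Cmin < Cmax)
    (β : ℝ) (hβ : 1 < β)
    (hM : ∀ t, 2 ≤ M t)
    (hn_top : Tendsto (fun t => IntegrativePrecision.minSize (n t)) atTop atTop)
    (hp_top : Tendsto p atTop atTop)
    (hs₁ : ∀ t, 3 ≤ s₁ t ∧ (s₁ t : ℝ) < p t / 2)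
    (hs₂ : ∀ t, 2 ≤ s₂ t ∧ (s₂ t : ℝ) < p t / 2)
    (hs₀ : (fun t => (max (s₁ t) (s₂ t) : ℝ) ^ 2 * Real.log (p t) ^ 3)
      =o[atTop] fun t => (IntegrativePrecision.totalSize (n t) : ℝ))
    (hs₂M : (fun t => (s₂ t : ℝ) ^ 2 * M t)
      =o[atTop] fun t => (IntegrativePrecision.totalSize (n t) : ℝ))
    (hN : (fun t => (IntegrativePrecision.totalSize (n t) : ℝ))
      =O[atTop] fun t => (IntegrativePrecision.minSize (n t) : ℝ) * M t)
    (hp : (fun t => (IntegrativePrecision.totalSize (n t) : ℝ) ^ β)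
      =O[atTop] fun t => (p t : ℝ))
    (r : ℝ) (hr : 1 ≤ r) (l : ENNReal) [Fact (1 ≤ l)] :
    ∃ c : ℝ, 0 < c ∧ ∀ᶠ t in atTop,
      ENNReal.ofReal
          (c * (s₁ t * IntegrativePrecision.psi₁ (p t) (IntegrativePrecision.totalSize (n t)) ^ r
            + s₂ t * IntegrativePrecision.psi₂ (M t) (p t)
                (IntegrativePrecision.totalSize (n t)) ^ r))
        ≤ IntegrativePrecision.minimaxRisk l (n t) (μ t) Cmin Cmax (s₁ t) (s₂ t)
            (IntegrativePrecision.loss₁ (n t) r) ∧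
      ENNReal.ofReal
          (c * (s₁ t * IntegrativePrecision.psi₁ (p t) (IntegrativePrecision.totalSize (n t)) ^ r
            + s₂ t * IntegrativePrecision.psi₂ (M t) (p t)
                (IntegrativePrecision.totalSize (n t)) ^ r))
        ≤ IntegrativePrecision.minimaxRisk l (n t) (μ t) Cmin Cmax (s₁ t) (s₂ t)
            (IntegrativePrecision.loss₂ (n t) r) := by
  -- `Cmin * a = 1 - d` and `Cmax * a = 1 + d`, which leaves room for small perturbations
  set a : ℝ := 2 / (Cmin + Cmax) with ha_def
  set d : ℝ := (Cmax - Cmin) / (Cmin + Cmax) with hd_def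
  have hsum : 0 < Cmin + Cmax := by linarith
  have ha : 0 < a := by positivity
  have hd0 : 0 < d := div_pos (by linarith) hsum
  have hd1 : d < 1 := (div_lt_one hsum).2 (by linarith)
  have hCa : Cmin * a = 1 - d := by rw [ha_def, hd_def]; field_simp; ring
  have hCb : Cmax * a = 1 + d := by rw [ha_def, hd_def]; field_simp; ring
  set η : ℝ := d / 8 with hη_def
  have hη0 : 0 < η := by positivity
  have hη : η ≤ 1 / 8 := by rw [hη_def]; linarith
  have hmin : Cmin * (a * (1 + η)) ≤ 1 := by rw [← mul_assoc, hCa, hη_def]; nlinarith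
  have hmax : 1 ≤ Cmax * (a * (1 - η)) := by rw [← mul_assoc, hCb, hη_def]; nlinarith
  obtain ⟨C, hC0, hNC⟩ := hN.exists_pos
  obtain ⟨C', hC'0, hpC⟩ := hp.exists_pos
  set κ := min ((a / 40) ^ r / 32) ((a / (160 * √C)) ^ r) with hκ
  have hκ0 : 0 < κ := by
    have := Real.sqrt_pos.2 hC0
    exact lt_min (div_pos (Real.rpow_pos_of_pos (by positivity) r) (by norm_num))
      (Real.rpow_pos_of_pos (by positivity) r)
  refine ⟨κ / (3 * 2 ^ r), div_pos hκ0 (mul_pos three_pos (Real.rpow_pos_of_pos two_pos r)), ?_⟩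
  have hNbig : Tendsto (fun t => (IntegrativePrecision.totalSize (n t) : ℝ)) atTop atTop := by
    refine tendsto_atTop_mono (fun t => ?_) (tendsto_natCast_atTop_atTop.comp hn_top)
    have h1 := IntegrativePrecision.minSize_le (n t) ⟨0, by have := hM t; omega⟩
    have h2 : n t ⟨0, by have := hM t; omega⟩ ≤ IntegrativePrecision.totalSize (n t) :=
      Finset.single_le_sum (f := n t) (fun _ _ => Nat.zero_le _) (Finset.mem_univ _)
    simp only [Function.comp_apply]
    exact_mod_cast h1.trans h2
  have hNβ : Tendsto (fun t => (IntegrativePrecision.totalSize (n t) : ℝ) ^ (β - 1)) atTop atTop :=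
    (tendsto_rpow_atTop (by linarith)).comp hNbig
  filter_upwards [hp_top.eventually_ge_atTop 1024, hn_top.eventually_ge_atTop 1,
    hNC.bound, hpC.bound, hs₀.bound (show 0 < η ^ 2 by positivity),
    hs₂M.bound (show 0 < η ^ 2 / C by positivity), hNβ.eventually_ge_atTop C',
    hNbig.eventually_ge_atTop 1] with t h1 h2 h3 h4 h5 h6 h7 h8
  simp only [Real.norm_eq_abs] at h3 h4 h5 h6
  set N := IntegrativePrecision.totalSize (n t) with hNt
  have hN0 : (0 : ℝ) < N := by linarith
  have hlog : 0 ≤ Real.log (p t) := Real.log_natCast_nonneg _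
  rw [abs_of_nonneg hN0.le] at h3 h5 h6
  rw [abs_of_nonneg (by positivity)] at h3 h5 h6
  rw [abs_of_nonneg (by positivity), abs_of_nonneg (by positivity)] at h4
  -- the excess of `β` over `1` absorbs the constant in `N ^ β = O(p)`
  have hNp : N ≤ p t := by
    have h9 : C' * (N : ℝ) ≤ C' * p t := by
      calc C' * (N : ℝ) ≤ (N : ℝ) ^ (β - 1) * N := by gcongr
        _ = (N : ℝ) ^ β := by rw [← Real.rpow_add_one hN0.ne', sub_add_cancel]
        _ ≤ _ := h4
    exact_mod_cast le_of_mul_le_mul_left h9 hC'0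
  have hs₂p : s₂ t + s₂ t ≤ p t := by
    have h9 := (hs₂ t).2
    have h10 : (s₂ t : ℝ) + s₂ t ≤ p t := by linarith
    exact_mod_cast h10
  have hqN : C * ((s₂ t : ℝ) ^ 2 * M t) ≤ η ^ 2 * N := by
    calc C * ((s₂ t : ℝ) ^ 2 * M t) ≤ C * (η ^ 2 / C * N) := by gcongr
      _ = _ := by field_simp
  have hmain : ∀ loss : IntegrativePrecision.MatTuple (M t) (p t) →
      IntegrativePrecision.MatTuple (M t) (p t) → Matrix (Fin (p t)) (Fin (p t)) ℝ,
      (∀ A B j k, IntegrativePrecision.wnorm₁ (n t) (fun m => A m j k - B m j k) ^ r ≤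
        loss A B j k) → _ := fun loss hloss =>
    IntegrativePrecision.ofReal_rate_le_minimaxRisk l (hM t) (n t) (μ t) hCmin hr hloss ha hη0 hη
      hmin hmax h1 h2 (hs₁ t).1 (hs₂ t).1 hs₂p hNp h5 hC0 h3 hqN hκ0 (min_le_left _ _)
      (min_le_right _ _)
  refine ⟨hmain _ fun A B j k => le_rfl, hmain _ fun A B j k => ?_⟩
  exact Real.rpow_le_rpow (IntegrativePrecision.wnorm₁_nonneg _ _)
    (IntegrativePrecision.wnorm₁_le_wnorm₂ _ _) (by linarith)
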